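/- Let $m \ge 2$, let $D \subset \mathbb{R}^m$ be a bounded domain (a non-empty, bounded, open and connected set), let $\lambda > 0$, and let $u \in C^0(D)$ be real-valued. For $r>0$ let $B_r(x)$ be the open ball of radius $r$ centred at $x$, and for $\overline{B_r(x)} \subset D$ let $$M^\circ(u,x,r) = \frac{1}{|\partial B_r|}\int_{\partial B_r(x)} u \, dS, \qquad M^\bullet(u,x,r) = \frac{1}{|B_r|}\int_{B_r(x)} u(y)\, dy$$ be the mean values of $u$ over the sphere and over the ball; $J_\nu$ denotes the Bessel function of the first kind of order $\nu$. Suppose that for every $x \in D$ there is $r(x) > 0$ with $\overline{B_{r(x)}(x)} \subset D$ such that $$m\, J_{m/2}(\lambda r)\, M^\circ(u,x,r) = \lambda r\, J_{(m-2)/2}(\lambda r)\, M^\bullet(u,x,r) \qquad \text{for all } r \in (0, r(x)).$$ Then $u$ is metaharmonic in $D$, that is, $u \in C^2(D)$ and $\nabla^2 u + \lambda^2 u = 0$ in $D$. -/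

import Mathlib

/-- The Bessel function of the first kind `J_ν(z)`, for real order `ν` and real argument `z > 0`,
by its power series. (`Real.Gamma` is `0` at the poles of the gamma function, so that the quotient
is then `0`, which is the usual convention for `1 / Γ`.) -/
noncomputable def besselJ (ν z : ℝ) : ℝ :=
  ∑' k : ℕ, (-1 : ℝ) ^ k / ((k.factorial : ℝ) * Real.Gamma (ν + k + 1)) * (z / 2) ^ (ν + 2 * k)

/-- The mean value `M°(u, x, r)` of `u` over the sphere of radius `r > 0` centred at `x`, with
respect to surface measure; the sphere is parametrised by `θ ↦ x + r θ`, `|θ| = 1`. -/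
noncomputable def sphereMean {m : ℕ} (u : EuclideanSpace ℝ (Fin m) → ℝ)
    (x : EuclideanSpace ℝ (Fin m)) (r : ℝ) : ℝ :=
  MeasureTheory.average
    (MeasureTheory.Measure.toSphere
      (MeasureTheory.volume : MeasureTheory.Measure (EuclideanSpace ℝ (Fin m))))
    (fun θ : Metric.sphere (0 : EuclideanSpace ℝ (Fin m)) 1 =>
      u (x + r • (θ : EuclideanSpace ℝ (Fin m))))

/-- The mean value `M•(u, x, r)` of `u` over the open ball of radius `r > 0` centred at `x`, with
respect to Lebesgue measure. -/
noncomputable def ballMean {m : ℕ} (u : EuclideanSpace ℝ (Fin m) → ℝ)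
    (x : EuclideanSpace ℝ (Fin m)) (r : ℝ) : ℝ :=
  MeasureTheory.average (MeasureTheory.volume.restrict (Metric.ball x r)) u

/-- `u` is metaharmonic on the open set `D`: it is of class `C²` on `D` and solves the Helmholtz
equation `∇²u + lam² u = 0` there. -/
def IsMetaharmonicOn {m : ℕ} (lam : ℝ) (u : EuclideanSpace ℝ (Fin m) → ℝ)
    (D : Set (EuclideanSpace ℝ (Fin m))) : Prop :=
  ContDiffOn ℝ 2 u D ∧ ∀ x ∈ D, Laplacian.laplacian u x + lam ^ 2 * u x = 0

/-! Write `J_ν(z) = (z/2)^ν j_ν(z²/4)` and fix `x`. Let `S(r)` be the integral of `u(x + rθ)` over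
the unit sphere, `F(r)` the integral of `u` over the ball, `K(r) = j_{(m-2)/2}(λ²r²/4)` and `B(r) =
r^m j_{m/2}(λ²r²/4)`. The hypothesis becomes `B S = 2 K F`. Polar coordinates give `F' = r^(m-1) S`,
and the Bessel recurrence gives `B' = 2 r^(m-1) K`, so `(F/B)' = 0`. Hence `S` is a multiple of `K`,
and `r → 0` fixes the factor: on small spheres about `x`, `u` has the same integrals as `u(x)` times
the radial Helmholtz solution about `x` (`sphereIntegral_eq_of_continuous`).

The admissible radii depend on `x` without any uniformity, so `u` cannot be mollified directly. The
information at a single point is however enough to make `u` a solution in the viscosity sense: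
comparison with the radial solution bounds the Laplacian of any function touching `u` at `x`
(`laplacian_ge_of_isLocalMax`).

For regularity, `U(x, t) = u(x) cosh(λt)` is harmonic in the viscosity sense in `m + 1` variables
(`isViscositySubharmonicAt_coshExtension`). With no zero-order term left, the maximum principle
holds on balls of every size. The Dirichlet problem on a ball with polynomial data has polynomial
solutions, so Stone–Weierstrass and the maximum principle make `U` a uniform limit of harmonic
polynomials (`exists_lap_eq_zero_near`). Their mean value property for one fixed smooth kernel
passes to `U`, which is thus locally a mollification and smooth (`exists_contDiff_eqOn_ball`).
Finally `u`, the slice `t = 0`, is itself an admissible test function from both sides, which gives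
the equation. -/

open MeasureTheory Metric Set Filter Topology
open scoped ContDiff

/-! ### Averages against smooth radial kernels. -/

section RadialAverage

variable {E : Type*} [NormedAddCommGroup E]

/-- A smooth radial function, positive on the ball of radius `a` about `0` and zero off it. -/
noncomputable def radialBump (a : ℝ) (y : E) : ℝ := Real.smoothTransition (a ^ 2 - ‖y‖ ^ 2)

/-- The radial kernel `κ` with `∇ (radialBump a) y = - κ y • y`. -/
noncomputable def radialKernel (a : ℝ) (y : E) : ℝ :=
  2 * deriv Real.smoothTransition (a ^ 2 - ‖y‖ ^ 2)

lemma radialBump_nonneg (a : ℝ) (y : E) : 0 ≤ radialBump a y := Real.smoothTransition.nonneg _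

lemma radialBump_pos {a : ℝ} {y : E} (h : ‖y‖ < a) : 0 < radialBump a y := by
  apply Real.smoothTransition.pos_of_pos
  nlinarith [norm_nonneg y]

lemma radialBump_eq_zero {a : ℝ} (ha : 0 < a) {y : E} (h : a ≤ ‖y‖) : radialBump a y = 0 := by
  apply Real.smoothTransition.zero_of_nonpos
  nlinarith [norm_nonneg y]

lemma radialKernel_nonneg (a : ℝ) (y : E) : 0 ≤ radialKernel a y :=
  mul_nonneg zero_le_two Real.smoothTransition.monotone.deriv_nonneg

lemma radialKernel_eq_zero {a : ℝ} (ha : 0 < a) {y : E} (h : a < ‖y‖) : radialKernel a y = 0 := by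
  have : Real.smoothTransition =ᶠ[𝓝 (a ^ 2 - ‖y‖ ^ 2)] fun _ => 0 := by
    filter_upwards [Iio_mem_nhds (show a ^ 2 - ‖y‖ ^ 2 < 0 by nlinarith [norm_nonneg y])] with t ht
    exact Real.smoothTransition.zero_of_nonpos ht.le
  simp [radialKernel, this.deriv_eq]

lemma radialKernel_neg (a : ℝ) (y : E) : radialKernel a (-y) = radialKernel a y := by
  simp [radialKernel]

variable [InnerProductSpace ℝ E]

lemma contDiff_radialBump (a : ℝ) : ContDiff ℝ ∞ (radialBump a : E → ℝ) :=
  Real.smoothTransition.contDiff.comp (contDiff_const.sub (contDiff_norm_sq ℝ))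

lemma contDiff_radialKernel (a : ℝ) : ContDiff ℝ ∞ (radialKernel a : E → ℝ) := by
  have h : ContDiff ℝ ∞ (deriv Real.smoothTransition) := by
    have := Real.smoothTransition.contDiff (n := ⊤)
    exact (contDiff_infty_iff_deriv.1 this).2
  exact contDiff_const.mul (h.comp (contDiff_const.sub (contDiff_norm_sq ℝ)))

lemma hasFDerivAt_radialBump (a : ℝ) (y : E) :
    HasFDerivAt (radialBump a) (-(radialKernel a y) • innerSL ℝ y) y := by
  have h1 : HasDerivAt Real.smoothTransition (deriv Real.smoothTransition (a ^ 2 - ‖y‖ ^ 2))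
      (a ^ 2 - ‖y‖ ^ 2) :=
    (Real.smoothTransition.contDiff (n := 1)).differentiable (by simp) _ |>.hasDerivAt
  have h2 : HasFDerivAt (fun y : E => a ^ 2 - ‖y‖ ^ 2) (-(2 • innerSL ℝ y)) y :=
    (hasStrictFDerivAt_norm_sq y).hasFDerivAt.const_sub _
  refine (h1.comp_hasFDerivAt y h2).congr_fderiv ?_
  ext v
  simp [radialKernel]
  ring

lemma hasCompactSupport_of_norm_lt [FiniteDimensional ℝ E] {F : Type*} [Zero F] {f : E → F} {a : ℝ}
    (h : ∀ y, a < ‖y‖ → f y = 0) : HasCompactSupport f := by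
  have := FiniteDimensional.proper_real E
  refine HasCompactSupport.intro (isCompact_closedBall (0 : E) a) fun y hy => h y ?_
  simpa using hy

lemma hasCompactSupport_radialKernel [FiniteDimensional ℝ E] {a : ℝ} (ha : 0 < a) :
    HasCompactSupport (radialKernel a : E → ℝ) :=
  hasCompactSupport_of_norm_lt fun _ => radialKernel_eq_zero ha

lemma hasCompactSupport_radialBump [FiniteDimensional ℝ E] {a : ℝ} (ha : 0 < a) :
    HasCompactSupport (radialBump a : E → ℝ) :=
  hasCompactSupport_of_norm_lt fun _ hy => radialBump_eq_zero ha hy.le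

lemma laplacian_eq_sum_fderiv_fderiv [FiniteDimensional ℝ E] {ι : Type*} [Fintype ι]
    (b : OrthonormalBasis ι ℝ E) {f : E → ℝ} (hf : ContDiff ℝ 2 f) (x : E) :
    Laplacian.laplacian f x = ∑ i, fderiv ℝ (fun z => fderiv ℝ f z (b i)) x (b i) := by
  rw [InnerProductSpace.laplacian_eq_iteratedFDeriv_orthonormalBasis f b]
  refine Finset.sum_congr rfl fun i _ => ?_
  have h : DifferentiableAt ℝ (fderiv ℝ f) x :=
    (hf.fderiv_right (m := 1) (by norm_num)).differentiable (by simp) x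
  rw [iteratedFDeriv_two_apply, fderiv_clm_apply h (by fun_prop)]
  simp

lemma continuous_laplacian [FiniteDimensional ℝ E] {f : E → ℝ} (hf : ContDiff ℝ 2 f) :
    Continuous (Laplacian.laplacian f) := by
  have : Laplacian.laplacian f = fun x => _ :=
    funext fun x => laplacian_eq_sum_fderiv_fderiv (stdOrthonormalBasis ℝ E) hf x
  rw [this]
  refine continuous_finsetSum _ fun i _ => ?_
  have h1 : ContDiff ℝ 1 fun z => fderiv ℝ f z (stdOrthonormalBasis ℝ E i) :=
    (hf.fderiv_right (m := 1) (by norm_num)).clm_apply contDiff_const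
  exact (h1.continuous_fderiv (by simp)).clm_apply continuous_const

variable [MeasurableSpace E] [BorelSpace E] (μ : Measure E) [μ.IsAddHaarMeasure]

/-- Differentiation of a weighted average of a `C¹` function with respect to the radius. -/
lemma hasDerivAt_integral_dilation {f k : E → ℝ} (hf : ContDiff ℝ 1 f) (hk : Continuous k)
    (hks : HasCompactSupport k) (x : E) (r : ℝ) :
    HasDerivAt (fun r : ℝ => ∫ y, f (x + r • y) * k y ∂μ)
      (∫ y, fderiv ℝ f (x + r • y) y * k y ∂μ) r := by
  have hf0 := hf.continuous
  have hf1 : Continuous fun p : ℝ × E => fderiv ℝ f (x + p.1 • p.2) p.2 * k p.2 :=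
    (((hf.continuous_fderiv (by simp)).comp (by fun_prop)).clm_apply continuous_snd).mul
      (hk.comp continuous_snd)
  obtain ⟨C, hC⟩ := ((isCompact_closedBall r 1).prod hks.isCompact).exists_bound_of_continuousOn
    hf1.continuousOn
  have hkint : ∀ r : ℝ, Integrable (fun y => f (x + r • y) * k y) μ := fun r =>
    Continuous.integrable_of_hasCompactSupport (by fun_prop) hks.mul_left
  refine (hasDerivAt_integral_of_dominated_loc_of_deriv_le (s := ball r 1)
    (bound := (tsupport k).indicator fun _ => C) (ball_mem_nhds r one_pos)
    (Eventually.of_forall fun r => (hkint r).aestronglyMeasurable) (hkint r)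
    (F' := fun r y => fderiv ℝ f (x + r • y) y * k y) ?_ ?_ ?_ ?_).2
  · exact (hf1.comp (by fun_prop : Continuous fun y : E => (r, y))).aestronglyMeasurable
  · refine Eventually.of_forall fun y s hs => ?_
    by_cases hy : y ∈ tsupport k
    · rw [indicator_of_mem hy]
      exact hC (s, y) ⟨ball_subset_closedBall hs, hy⟩
    · simp [image_eq_zero_of_notMem_tsupport hy, hy]
  · exact (integrable_indicator_iff (isClosed_tsupport k).measurableSet).2
      (integrableOn_const hks.isCompact.measure_lt_top.ne)
  · refine Eventually.of_forall fun y s _ => HasDerivAt.mul_const ?_ _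
    have h1 : HasDerivAt (fun s : ℝ => x + s • y) y s := by
      simpa using ((hasDerivAt_id s).smul_const y).const_add x
    exact ((hf.differentiable (by simp) _).hasFDerivAt).comp_hasDerivAt s h1

variable [FiniteDimensional ℝ E]

/-- The derivative of a radial average with respect to the radius. -/
lemma hasDerivAt_integral_radialKernel {f : E → ℝ} (hf : ContDiff ℝ 2 f) {a : ℝ} (ha : 0 < a)
    (x : E) (r : ℝ) :
    HasDerivAt (fun r : ℝ => ∫ y, f (x + r • y) * radialKernel a y ∂μ)
      (r * ∫ y, Laplacian.laplacian f (x + r • y) * radialBump a y ∂μ) r := by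
  have hk : Continuous (radialKernel a : E → ℝ) := (contDiff_radialKernel a).continuous
  have hψ : Continuous (radialBump a : E → ℝ) := (contDiff_radialBump a).continuous
  have hks := hasCompactSupport_radialKernel (E := E) ha
  have hψs := hasCompactSupport_radialBump (E := E) ha
  refine (hasDerivAt_integral_dilation μ (hf.of_le (by norm_num)) hk hks x r).congr_deriv ?_
  let b := stdOrthonormalBasis ℝ E
  let g := fun i (y : E) => fderiv ℝ f (x + r • y) (b i)
  have hg0 : ∀ i, ContDiff ℝ 1 fun z => fderiv ℝ f z (b i) := fun i =>
    (hf.fderiv_right (m := 1) (by norm_num)).clm_apply contDiff_const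
  have hg : ∀ i, ContDiff ℝ 1 (g i) := fun i =>
    (hg0 i).comp (contDiff_const.add (contDiff_const.smul contDiff_id))
  have hg' : ∀ i y, fderiv ℝ (g i) y (b i)
      = r * fderiv ℝ (fun z => fderiv ℝ f z (b i)) (x + r • y) (b i) := by
    intro i y
    have h1 : HasFDerivAt (fun y : E => x + r • y) (r • ContinuousLinearMap.id ℝ E) y :=
      ((hasFDerivAt_id y).const_smul r).const_add x
    have h2 := (((hg0 i).differentiable (by simp) (x + r • y)).hasFDerivAt).comp y h1
    have h3 : fderiv ℝ (g i) y = _ := h2.fderiv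
    rw [h3]
    simp
  have hψ' : ∀ i y, fderiv ℝ (radialBump a) y (b i) = -(radialKernel a y * inner ℝ y (b i)) := by
    intro i y
    rw [(hasFDerivAt_radialBump a y).fderiv]
    simp
  have hI : ∀ (i) , Integrable (fun y => fderiv ℝ (g i) y (b i) * radialBump a y) μ := fun i =>
    Continuous.integrable_of_hasCompactSupport
      ((((hg i).continuous_fderiv (by simp)).clm_apply continuous_const).mul hψ) hψs.mul_left
  have hJ : ∀ i, Integrable (fun y => g i y * fderiv ℝ (radialBump a) y (b i)) μ := by
    intro i
    simp only [hψ']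
    refine Continuous.integrable_of_hasCompactSupport
      ((hg i).continuous.mul (by fun_prop)) (HasCompactSupport.mul_left ?_)
    exact HasCompactSupport.neg hks.mul_right
  -- Since `κ y • y` is minus the gradient of the bump `ψ`, the integrand is `-∇f(x + r y) · ∇ψ(y)`.
  -- Integration by parts moves the derivative onto `∇f(x + r y)`, and the chain rule produces the
  -- factor `r`.
  calc ∫ y, fderiv ℝ f (x + r • y) y * radialKernel a y ∂μ
      = ∫ y, ∑ i, -(g i y * fderiv ℝ (radialBump a) y (b i)) ∂μ := by
        refine integral_congr_ae (Eventually.of_forall fun y => ?_)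
        have : fderiv ℝ f (x + r • y) y = ∑ i, inner ℝ y (b i) * g i y := by
          have h := congrArg (fderiv ℝ f (x + r • y)) (b.sum_repr' y)
          rw [← h, map_sum]
          exact Finset.sum_congr rfl fun i _ => by simp [g, real_inner_comm]
        simp only [this, hψ', Finset.sum_mul]
        exact Finset.sum_congr rfl fun i _ => by ring
    _ = ∑ i, ∫ y, fderiv ℝ (g i) y (b i) * radialBump a y ∂μ := by
        rw [integral_finsetSum _ fun i _ => by exact (hJ i).neg]
        refine Finset.sum_congr rfl fun i _ => ?_
        rw [integral_neg, integral_mul_fderiv_eq_neg_fderiv_mul_of_integrable (hI i) (hJ i), neg_neg]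
        · exact Continuous.integrable_of_hasCompactSupport ((hg i).continuous.mul hψ) hψs.mul_left
        · exact fun y _ => (hg i).differentiable (by simp) y
        · exact fun y _ => (hasFDerivAt_radialBump a y).differentiableAt
    _ = r * ∫ y, Laplacian.laplacian f (x + r • y) * radialBump a y ∂μ := by
        rw [← integral_finsetSum _ fun i _ => hI i, ← integral_const_mul]
        refine integral_congr_ae (Eventually.of_forall fun y => ?_)
        simp only [hg', laplacian_eq_sum_fderiv_fderiv b hf, Finset.sum_mul, Finset.mul_sum]
        exact Finset.sum_congr rfl fun i _ => by ring

/-- The mean value property of harmonic functions, for radial averages. -/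
lemma integral_radialKernel_of_laplacian_eq_zero {f : E → ℝ} (hf : ContDiff ℝ 2 f)
    (hΔ : ∀ x, Laplacian.laplacian f x = 0) {a : ℝ} (ha : 0 < a) (x : E) :
    ∫ y, f (x + y) * radialKernel a y ∂μ = f x * ∫ y, (radialKernel a y : ℝ) ∂μ := by
  have h := fun r => hasDerivAt_integral_radialKernel μ hf ha x r
  have := is_const_of_deriv_eq_zero (fun r => (h r).differentiableAt)
    (fun r => by rw [(h r).deriv]; simp [hΔ]) 1 0
  simpa [integral_const_mul] using this

/-- A function whose radial averages near `x` do not exceed its value at `x` has non-positive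
Laplacian there. -/
lemma laplacian_nonpos_of_radialAverage_le {f : E → ℝ} (hf : ContDiff ℝ 2 f) {x : E}
    (h : ∀ᶠ a in 𝓝[>] (0 : ℝ), ∫ y, f (x + y) * radialKernel a y ∂μ
      ≤ f x * ∫ y, (radialKernel a y : ℝ) ∂μ) :
    Laplacian.laplacian f x ≤ 0 := by
  by_contra! hpos
  obtain ⟨δ, hδ, hball⟩ := Metric.eventually_nhds_iff.1
    ((continuous_laplacian hf).continuousAt.eventually (lt_mem_nhds hpos))
  obtain ⟨a, hle, ha⟩ := (h.and (Ioo_mem_nhdsGT hδ)).exists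
  have hd := fun r => hasDerivAt_integral_radialKernel μ hf ha.1 x r
  -- A positive Laplacian on the ball of radius `δ > a` makes the dilated average strictly
  -- increasing; its values at `r = 0` and `r = 1` are the two sides of `hle`.
  have hmono : StrictMonoOn (fun r : ℝ => ∫ y, f (x + r • y) * radialKernel a y ∂μ) (Icc 0 1) := by
    refine strictMonoOn_of_deriv_pos (convex_Icc 0 1)
      (fun r _ => (hd r).continuousAt.continuousWithinAt) fun r hr => ?_
    rw [interior_Icc] at hr
    rw [(hd r).deriv]
    refine mul_pos hr.1 ?_
    have hcont : Continuous fun y => Laplacian.laplacian f (x + r • y) * radialBump a y :=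
      ((continuous_laplacian hf).comp (by fun_prop)).mul (contDiff_radialBump a).continuous
    refine hcont.integral_pos_of_hasCompactSupport_nonneg_nonzero
      (hasCompactSupport_radialBump ha.1).mul_left (fun y => ?_) (x := 0) ?_
    · rcases lt_or_ge ‖y‖ a with hy | hy
      · refine mul_nonneg (hball ?_).le (radialBump_nonneg a y)
        rw [dist_eq_norm, add_sub_cancel_left, norm_smul, Real.norm_of_nonneg hr.1.le]
        nlinarith [hr.1, hr.2, ha.2, norm_nonneg y]
      · simp [radialBump_eq_zero ha.1 hy]
    · simpa using ⟨hpos.ne', (radialBump_pos (E := E) (y := 0) (by simpa using ha.1)).ne'⟩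
  have := hmono (left_mem_Icc.2 zero_le_one) (right_mem_Icc.2 zero_le_one) zero_lt_one
  simp only [zero_smul, one_smul, add_zero, integral_const_mul] at this
  linarith

/-- If the kernel vanished identically, so would the gradient of the bump, which is positive at `0`
and zero far away. -/
lemma integral_radialKernel_pos [Nontrivial E] {a : ℝ} (ha : 0 < a) :
    0 < ∫ y, (radialKernel a y : ℝ) ∂μ := by
  have hcont : Continuous (radialKernel a : E → ℝ) := (contDiff_radialKernel a).continuous
  obtain ⟨y, hy⟩ : ∃ y : E, radialKernel a y ≠ 0 := by
    by_contra! hzero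
    have hconst := is_const_of_fderiv_eq_zero (𝕜 := ℝ)
      (fun y : E => (hasFDerivAt_radialBump a y).differentiableAt)
      (fun y => by rw [(hasFDerivAt_radialBump a y).fderiv, hzero]; simp)
    obtain ⟨y, hy⟩ := NormedSpace.exists_lt_norm ℝ E a
    have h1 := radialBump_pos (E := E) (y := 0) (by simpa using ha)
    rw [hconst 0 y, radialBump_eq_zero ha hy.le] at h1
    exact h1.false
  exact hcont.integral_pos_of_hasCompactSupport_nonneg_nonzero
    (hasCompactSupport_radialKernel ha) (radialKernel_nonneg a) hy

end RadialAverage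

/-! ### Polar coordinates. -/

section PolarCoordinates

variable {E : Type*} [NormedAddCommGroup E] [NormedSpace ℝ E] [FiniteDimensional ℝ E]
  [MeasurableSpace E] [BorelSpace E] (μ : Measure E) [μ.IsAddHaarMeasure]

lemma continuous_integral_sphere {u : E → ℝ} (hu : Continuous u) (x : E) :
    Continuous fun t : ℝ => ∫ θ : sphere (0 : E) 1, u (x + t • (θ : E)) ∂μ.toSphere := by
  simpa using continuous_parametric_integral_of_continuous (μ := μ.toSphere)
    (f := fun (t : ℝ) (θ : sphere (0 : E) 1) => u (x + t • (θ : E))) (by fun_prop) isCompact_univ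

variable [Nontrivial E]

/-- Integration in polar coordinates. -/
lemma integral_eq_integral_Ioi_integral_sphere {f : E → ℝ} (hf : Integrable f μ) :
    ∫ y, f y ∂μ = ∫ t in Ioi (0 : ℝ), t ^ (Module.finrank ℝ E - 1) *
      ∫ θ : sphere (0 : E) 1, f (t • (θ : E)) ∂μ.toSphere := by
  have hmp := μ.measurePreserving_homeomorphUnitSphereProd
  have hemb := (homeomorphUnitSphereProd E).measurableEmbedding
  let g : sphere (0 : E) 1 × Ioi (0 : ℝ) → ℝ := fun p => f ((p.2 : ℝ) • (p.1 : E))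
  have hgf : ∀ y : ({0}ᶜ : Set E), g (homeomorphUnitSphereProd E y) = f y := by
    intro y
    have : ‖(y : E)‖ ≠ 0 := norm_ne_zero_iff.2 y.2
    simp [g, smul_smul, this]
  have hint : Integrable g (μ.toSphere.prod (.volumeIoiPow (Module.finrank ℝ E - 1))) := by
    rw [← hmp.integrable_comp_emb hemb]
    have : g ∘ homeomorphUnitSphereProd E = f ∘ Subtype.val := funext hgf
    rw [this, ← integrableOn_iff_comap_subtypeVal (measurableSet_singleton _).compl]
    exact hf.integrableOn
  calc ∫ y, f y ∂μ = ∫ y : ({0}ᶜ : Set E), f y ∂(μ.comap (↑)) := by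
        rw [integral_subtype_comap (measurableSet_singleton _).compl, restrict_compl_singleton]
    _ = ∫ p, g p ∂(μ.toSphere.prod (.volumeIoiPow (Module.finrank ℝ E - 1))) := by
        rw [← hmp.integral_comp hemb]
        simp only [hgf]
    _ = ∫ t : Ioi (0 : ℝ), ∫ θ : sphere (0 : E) 1, f ((t : ℝ) • (θ : E)) ∂μ.toSphere
          ∂(.volumeIoiPow (Module.finrank ℝ E - 1)) := integral_prod_symm _ hint
    _ = _ := by
        simp only [Measure.volumeIoiPow, ENNReal.ofReal]
        rw [integral_withDensity_eq_integral_smul,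
          integral_subtype_comap measurableSet_Ioi fun a : ℝ =>
            Real.toNNReal (a ^ (Module.finrank ℝ E - 1)) •
              ∫ θ : sphere (0 : E) 1, f (a • (θ : E)) ∂μ.toSphere]
        · refine setIntegral_congr_fun measurableSet_Ioi fun t ht => ?_
          simp only [NNReal.smul_def, smul_eq_mul]
          rw [Real.coe_toNNReal _ (pow_nonneg (le_of_lt ht) _)]
        · exact (measurable_subtype_coe.pow_const _).real_toNNReal

/-- Transfers equality of spherical integrals to averages against a radial kernel, which is constant
on each sphere. -/
lemma integral_congr_of_sphere {f g : E → ℝ} (hf : Integrable f μ) (hg : Integrable g μ)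
    (h : ∀ t : ℝ, 0 < t → ∫ θ : sphere (0 : E) 1, f (t • (θ : E)) ∂μ.toSphere
      = ∫ θ : sphere (0 : E) 1, g (t • (θ : E)) ∂μ.toSphere) :
    ∫ y, f y ∂μ = ∫ y, g y ∂μ := by
  rw [integral_eq_integral_Ioi_integral_sphere μ hf, integral_eq_integral_Ioi_integral_sphere μ hg]
  exact setIntegral_congr_fun measurableSet_Ioi fun t ht => by simp only [h t ht]

lemma setIntegral_ball_eq_intervalIntegral {u : E → ℝ} (hu : Continuous u) (x : E) {r : ℝ}
    (hr : 0 ≤ r) :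
    ∫ y in ball x r, u y ∂μ = ∫ t in (0 : ℝ)..r, t ^ (Module.finrank ℝ E - 1) *
      ∫ θ : sphere (0 : E) 1, u (x + t • (θ : E)) ∂μ.toSphere := by
  have h1 : ∫ y in ball x r, u y ∂μ = ∫ y, (ball 0 r).indicator (fun y => u (x + y)) y ∂μ := by
    rw [← integral_indicator measurableSet_ball, ← integral_add_left_eq_self _ x]
    congr with y
    simp [indicator]
  have h2 : Integrable ((ball 0 r).indicator (fun y => u (x + y))) μ := by
    rw [integrable_indicator_iff measurableSet_ball]
    exact ((hu.comp (continuous_const.add continuous_id)).continuousOn.integrableOn_compact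
      (isCompact_closedBall 0 r)).mono_set ball_subset_closedBall
  rw [h1, integral_eq_integral_Ioi_integral_sphere μ h2, intervalIntegral.integral_of_le hr,
    integral_Ioc_eq_integral_Ioo, ← inter_eq_right.2 (Ioo_subset_Ioi_self : Ioo 0 r ⊆ Ioi 0),
    ← setIntegral_indicator measurableSet_Ioo]
  refine setIntegral_congr_fun measurableSet_Ioi fun t ht => ?_
  have hn : ∀ θ : sphere (0 : E) 1, ‖t • (θ : E)‖ = t := fun θ => by
    rw [norm_smul, Real.norm_of_nonneg (le_of_lt ht)]; simp
  by_cases htr : t < r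
  · rw [indicator_of_mem (show t ∈ Ioo 0 r from ⟨ht, htr⟩)]
    congr 1
    refine integral_congr_ae (Eventually.of_forall fun θ => ?_)
    simp [hn θ, htr]
  · rw [indicator_of_notMem (show t ∉ Ioo 0 r from fun h => htr h.2)]
    simp [indicator, hn, htr]

end PolarCoordinates

/-! ### Bessel functions as entire power series. -/

section Bessel

/-- The entire function `j_ν` with `J_ν(z) = (z / 2) ^ ν * j_ν(z ^ 2 / 4)`. -/
noncomputable def besselSeries (ν s : ℝ) : ℝ :=
  ∑' k : ℕ, (-1 : ℝ) ^ k / ((k.factorial : ℝ) * Real.Gamma (ν + k + 1)) * s ^ k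

lemma besselJ_eq (ν : ℝ) {z : ℝ} (hz : 0 < z) :
    besselJ ν z = (z / 2) ^ ν * besselSeries ν (z ^ 2 / 4) := by
  rw [besselJ, besselSeries, ← tsum_mul_left]
  refine tsum_congr fun k => ?_
  have : (2 * (k : ℝ)) = ((2 * k : ℕ) : ℝ) := by push_cast; ring
  rw [Real.rpow_add (by positivity), this, Real.rpow_natCast, pow_mul,
    show z ^ 2 / 4 = (z / 2) ^ 2 by ring]
  ring

/-- The gamma function is not monotone on `[1, 2]`, but each integer step multiplies it by `ν + k +
1 ≥ 1`. The resulting coefficient bound dominates the Bessel series by an exponential series. -/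
lemma Gamma_le_Gamma_add_nat {ν : ℝ} (hν : 0 ≤ ν) (k : ℕ) :
    Real.Gamma (ν + 1) ≤ Real.Gamma (ν + k + 1) := by
  induction k with
  | zero => simp
  | succ k ih =>
    refine ih.trans ?_
    rw [show ν + (k + 1 : ℕ) + 1 = (ν + k + 1) + 1 by push_cast; ring,
      Real.Gamma_add_one (show ν + k + 1 ≠ 0 by positivity)]
    exact le_mul_of_one_le_left (Real.Gamma_pos_of_pos (show 0 < ν + k + 1 by positivity)).le
      (by linarith [(Nat.cast_nonneg k : (0 : ℝ) ≤ k)])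

lemma abs_besselSeries_coeff_le {ν : ℝ} (hν : 0 ≤ ν) (k : ℕ) :
    |(-1 : ℝ) ^ k / ((k.factorial : ℝ) * Real.Gamma (ν + k + 1))|
      ≤ (Real.Gamma (ν + 1))⁻¹ * (k.factorial : ℝ)⁻¹ := by
  have h0 := Real.Gamma_pos_of_pos (show 0 < ν + 1 by positivity)
  have h1 := Gamma_le_Gamma_add_nat hν k
  rw [abs_div, abs_pow, abs_neg, abs_one, one_pow, one_div,
    abs_of_pos (mul_pos (by positivity) (h0.trans_le h1)), mul_inv, mul_comm]
  gcongr

lemma hasSum_besselSeries {ν : ℝ} (hν : 0 ≤ ν) (s : ℝ) :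
    HasSum (fun k : ℕ => (-1 : ℝ) ^ k / ((k.factorial : ℝ) * Real.Gamma (ν + k + 1)) * s ^ k)
      (besselSeries ν s) := by
  refine Summable.hasSum (Summable.of_norm_bounded
    (g := fun k : ℕ => (Real.Gamma (ν + 1))⁻¹ * (|s| ^ k / (k.factorial : ℝ)))
    ((Real.summable_pow_div_factorial |s|).mul_left _) fun k => ?_)
  rw [norm_mul, norm_pow, Real.norm_eq_abs, Real.norm_eq_abs]
  refine (mul_le_mul_of_nonneg_right (abs_besselSeries_coeff_le hν k) (by positivity)).trans_eq ?_
  ring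

lemma besselSeries_coeff_succ (ν : ℝ) (k : ℕ) :
    (-1 : ℝ) ^ (k + 1) / (((k + 1).factorial : ℝ) * Real.Gamma (ν + (k + 1 : ℕ) + 1)) * (k + 1 : ℕ)
      = -((-1 : ℝ) ^ k / ((k.factorial : ℝ) * Real.Gamma (ν + 1 + k + 1))) := by
  have hk : ((k : ℝ) + 1) ≠ 0 := by positivity
  rw [Nat.factorial_succ, show ν + (k + 1 : ℕ) + 1 = ν + 1 + k + 1 by push_cast; ring, pow_succ]
  push_cast
  rw [mul_assoc ((k : ℝ) + 1), mul_comm ((k : ℝ) + 1) (_ * _), div_mul_eq_mul_div,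
    mul_div_mul_right _ _ hk]
  ring

/-- Termwise differentiation, dominated on a ball containing `s`; the `k = 0` term drops out and
`besselSeries_coeff_succ` identifies the shifted series. -/
lemma hasDerivAt_besselSeries {ν : ℝ} (hν : 0 ≤ ν) (s : ℝ) :
    HasDerivAt (besselSeries ν) (-besselSeries (ν + 1) s) s := by
  let c := fun k : ℕ => (-1 : ℝ) ^ k / ((k.factorial : ℝ) * Real.Gamma (ν + k + 1))
  let R := |s| + 1
  have hR : 0 ≤ R := by positivity
  let B := fun k : ℕ => (Real.Gamma (ν + 1))⁻¹ * ((k.factorial : ℝ)⁻¹ * (k * R ^ (k - 1)))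
  have hB : Summable B := by
    refine Summable.mul_left _ ((summable_nat_add_iff 1).1 ?_)
    refine (Real.summable_pow_div_factorial R).congr fun k => ?_
    have hk : ((k : ℝ) + 1) ≠ 0 := by positivity
    rw [Nat.factorial_succ]
    push_cast
    field_simp
  have hmem : s ∈ ball (0 : ℝ) R := by simp [R]
  have hder : ∀ k : ℕ, ∀ y ∈ ball (0 : ℝ) R,
      HasDerivAt (fun y => c k * y ^ k) (c k * (k * y ^ (k - 1))) y := fun k y _ =>
    (hasDerivAt_pow k y).const_mul _
  have hbd : ∀ k : ℕ, ∀ y ∈ ball (0 : ℝ) R, ‖c k * (k * y ^ (k - 1))‖ ≤ B k := by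
    intro k y hy
    have hy' : |y| ≤ R := by simpa using (mem_ball_zero_iff.1 hy).le
    rw [norm_mul, norm_mul, norm_pow, Real.norm_eq_abs, Real.norm_eq_abs, Real.norm_eq_abs,
      Nat.abs_cast]
    refine (mul_le_mul (abs_besselSeries_coeff_le hν k) (mul_le_mul_of_nonneg_left
      (pow_le_pow_left₀ (abs_nonneg y) hy' _) (Nat.cast_nonneg k)) (by positivity)
      (mul_nonneg (inv_nonneg.2 (Real.Gamma_pos_of_pos (by positivity)).le) (by positivity))).trans_eq ?_
    simp only [B]; ring
  have hmain := hasDerivAt_tsum_of_isPreconnected hB isOpen_ball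
    (convex_ball (0 : ℝ) R).isPreconnected hder hbd hmem (hasSum_besselSeries hν s).summable hmem
  refine hmain.congr_deriv ?_
  have hsum : Summable fun k : ℕ => c k * (k * s ^ (k - 1)) :=
    Summable.of_norm_bounded hB fun k => hbd k s hmem
  rw [hsum.tsum_eq_zero_add, besselSeries, ← tsum_neg]
  simp only [Nat.cast_zero, zero_mul, mul_zero, zero_add]
  refine tsum_congr fun k => ?_
  have := besselSeries_coeff_succ ν k
  simp only [c, Nat.add_sub_cancel]
  rw [← mul_assoc, this]
  ring

lemma contDiff_besselSeries {ν : ℝ} (hν : 0 ≤ ν) (n : ℕ) : ContDiff ℝ n (besselSeries ν) := by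
  induction n generalizing ν with
  | zero =>
    exact contDiff_zero.2 (continuous_iff_continuousAt.2 fun s =>
      (hasDerivAt_besselSeries hν s).continuousAt)
  | succ n ih =>
    push_cast
    refine contDiff_succ_iff_deriv.2 ⟨fun s => (hasDerivAt_besselSeries hν s).differentiableAt,
      by simp, ?_⟩
    have : deriv (besselSeries ν) = fun s => -besselSeries (ν + 1) s :=
      funext fun s => (hasDerivAt_besselSeries hν s).deriv
    rw [this]
    exact (ih (by positivity)).neg

/-- This is `J_ν + J_{ν+2} = (2(ν+1)/z) J_{ν+1}` with the powers of `z/2` removed. With `c_{ν,k}`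
the coefficients, `c_{ν,k} = (ν+k+1) c_{ν+1,k}`, so `c_{ν,k} - (ν+1) c_{ν+1,k} = k c_{ν+1,k}`, which
is `-c_{ν+2,k-1}` for `k ≥ 1`. -/
lemma besselSeries_recurrence {ν : ℝ} (hν : 0 ≤ ν) (s : ℝ) :
    (ν + 1) * besselSeries (ν + 1) s - s * besselSeries (ν + 2) s = besselSeries ν s := by
  have h1 := (hasSum_besselSeries (show 0 ≤ ν + 1 by positivity) s).mul_left (ν + 1)
  have h2 := (hasSum_besselSeries (show 0 ≤ ν + 2 by positivity) s).mul_left s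
  have h0 := hasSum_besselSeries hν s
  have h3 : HasSum (fun k : ℕ => (-1 : ℝ) ^ k / ((k.factorial : ℝ) * Real.Gamma (ν + k + 1)) * s ^ k
      - (ν + 1) * ((-1 : ℝ) ^ k / ((k.factorial : ℝ) * Real.Gamma (ν + 1 + k + 1)) * s ^ k))
      (-(s * besselSeries (ν + 2) s)) := by
    refine (hasSum_nat_add_iff' 1).1 ?_
    -- The constant term vanishes, which allows the index shift matching the extra factor `s`.
    have hz : (-1 : ℝ) ^ 0 / (((0 : ℕ).factorial : ℝ) * Real.Gamma (ν + (0 : ℕ) + 1)) * s ^ 0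
      - (ν + 1) * ((-1 : ℝ) ^ 0 / (((0 : ℕ).factorial : ℝ) * Real.Gamma (ν + 1 + (0 : ℕ) + 1)) * s ^ 0)
        = 0 := by
      have hG := (Real.Gamma_pos_of_pos (show 0 < ν + 1 by positivity)).ne'
      have hν1 : ν + 1 ≠ 0 := by positivity
      simp only [Nat.cast_zero, add_zero, Real.Gamma_add_one hν1]
      field_simp
      simp
    rw [Finset.sum_range_one, hz, sub_zero]
    refine h2.neg.congr_fun ?_
    intro k
    have hG := (Real.Gamma_pos_of_pos (show 0 < ν + k + 2 by positivity)).ne'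
    have hk : ν + (k + 2 : ℝ) ≠ 0 := by positivity
    have e := besselSeries_coeff_succ (ν + 1) k
    have e' : Real.Gamma (ν + 1 + (k + 1 : ℕ) + 1)
        = (ν + (k + 1 : ℕ) + 1) * Real.Gamma (ν + (k + 1 : ℕ) + 1) := by
      rw [← Real.Gamma_add_one (by positivity)]
      congr 1; ring
    have hG1 := (Real.Gamma_pos_of_pos (show 0 < ν + (k + 1 : ℕ) + 1 by positivity)).ne'
    have hp : ν + (k + 1 : ℕ) + 1 ≠ 0 := by positivity
    have e2 : (-1 : ℝ) ^ (k + 1) / (((k + 1).factorial : ℝ) * Real.Gamma (ν + (k + 1 : ℕ) + 1))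
        = (ν + (k + 1 : ℕ) + 1) * ((-1 : ℝ) ^ (k + 1) /
          (((k + 1).factorial : ℝ) * Real.Gamma (ν + 1 + (k + 1 : ℕ) + 1))) := by
      rw [e']; field_simp
    rw [show ν + 2 + (k : ℝ) + 1 = ν + 1 + 1 + k + 1 by ring, e2, pow_succ s]
    linear_combination (s ^ k * s) * e
  have h4 := (h0.sub h1).unique h3
  linarith

lemma besselSeries_zero (ν : ℝ) : besselSeries ν 0 = (Real.Gamma (ν + 1))⁻¹ := by
  rw [besselSeries, tsum_eq_single 0 fun k hk => by simp [hk]]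
  simp

end Bessel

/-! ### From the mean value relation to viscosity solutions of the Helmholtz equation. -/

section MeanValue

/-- The derivative of `r ↦ r ^ m * j_{m/2}(λ² r² / 4)`. -/
lemma hasDerivAt_pow_mul_besselSeries {m : ℕ} (hm : 2 ≤ m) (lam r : ℝ) :
    HasDerivAt (fun r : ℝ => r ^ m * besselSeries ((m : ℝ) / 2) ((lam * r) ^ 2 / 4))
      (2 * r ^ (m - 1) * besselSeries (((m : ℝ) - 2) / 2) ((lam * r) ^ 2 / 4)) r := by
  obtain ⟨k, rfl⟩ := Nat.exists_eq_add_of_le hm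
  have hν : (0 : ℝ) ≤ (((2 + k : ℕ) : ℝ) - 2) / 2 := by
    push_cast; linarith [(Nat.cast_nonneg k : (0 : ℝ) ≤ k)]
  have h1 : HasDerivAt (fun r : ℝ => (lam * r) ^ 2 / 4) (lam ^ 2 * r / 2) r := by
    refine ((((hasDerivAt_id r).const_mul lam).pow 2).div_const 4).congr_deriv ?_
    simp; ring
  have h2 := (hasDerivAt_besselSeries (show (0 : ℝ) ≤ ((2 + k : ℕ) : ℝ) / 2 by positivity)
    ((lam * r) ^ 2 / 4)).comp r h1
  refine ((hasDerivAt_pow (2 + k) r).mul h2).congr_deriv ?_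
  -- The product rule gives `2 r^(m-1) ((m/2) j_{m/2} - s j_{m/2+1})` with `s = (λr)²/4`; the
  -- recurrence at `ν = (m-2)/2` collapses the bracket.
  have h3 := besselSeries_recurrence hν ((lam * r) ^ 2 / 4)
  rw [show (((2 + k : ℕ) : ℝ) - 2) / 2 + 1 = ((2 + k : ℕ) : ℝ) / 2 by ring,
    show (((2 + k : ℕ) : ℝ) - 2) / 2 + 2 = ((2 + k : ℕ) : ℝ) / 2 + 1 by ring] at h3
  rw [← h3, show 2 + k - 1 = k + 1 by omega, pow_add r 2 k]
  simp only [Function.comp]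
  ring

variable {m : ℕ}

/-- The integral of `u` over the sphere of radius `r` about `x`, normalised to the unit sphere. -/
noncomputable def sphereIntegral (u : EuclideanSpace ℝ (Fin m) → ℝ)
    (x : EuclideanSpace ℝ (Fin m)) (r : ℝ) : ℝ :=
  ∫ θ : sphere (0 : EuclideanSpace ℝ (Fin m)) 1, u (x + r • (θ : EuclideanSpace ℝ (Fin m)))
    ∂(volume : Measure (EuclideanSpace ℝ (Fin m))).toSphere

/-- The radial solution of the Helmholtz equation about `x` with value `1` at `x`. -/
noncomputable def radialSolution (lam : ℝ) (x y : EuclideanSpace ℝ (Fin m)) : ℝ :=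
  Real.Gamma ((m : ℝ) / 2) * besselSeries (((m : ℝ) - 2) / 2) (lam ^ 2 / 4 * ‖y - x‖ ^ 2)

/-- The unit sphere has measure `m` times the volume of the unit ball, so the factor `m`, the volume
and the powers of `λr/2` all cancel. -/
lemma besselSeries_relation (hm : 2 ≤ m) {lam r : ℝ} (hlam : 0 < lam) (hr : 0 < r)
    {u : EuclideanSpace ℝ (Fin m) → ℝ} {x : EuclideanSpace ℝ (Fin m)}
    (h : (m : ℝ) * besselJ ((m : ℝ) / 2) (lam * r) * sphereMean u x r
      = lam * r * besselJ (((m : ℝ) - 2) / 2) (lam * r) * ballMean u x r) :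
    r ^ m * besselSeries ((m : ℝ) / 2) ((lam * r) ^ 2 / 4) * sphereIntegral u x r
      = 2 * besselSeries (((m : ℝ) - 2) / 2) ((lam * r) ^ 2 / 4) * ∫ y in ball x r, u y := by
  have hm0 : (m : ℝ) ≠ 0 := by positivity
  have : Nontrivial (EuclideanSpace ℝ (Fin m)) := by
    have : Nonempty (Fin m) := ⟨⟨0, by omega⟩⟩
    infer_instance
  have hV : 0 < (volume : Measure (EuclideanSpace ℝ (Fin m))).real (ball 0 1) :=
    ENNReal.toReal_pos (measure_ball_pos _ _ one_pos).ne' measure_ball_lt_top.ne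
  have hball : (volume : Measure (EuclideanSpace ℝ (Fin m))).real (ball x r)
      = r ^ m * (volume : Measure (EuclideanSpace ℝ (Fin m))).real (ball 0 1) := by
    rw [measureReal_def, Measure.addHaar_ball _ _ hr.le, ENNReal.toReal_mul,
      ENNReal.toReal_ofReal (by positivity), finrank_euclideanSpace_fin, measureReal_def]
  have hz : 0 < lam * r := mul_pos hlam hr
  rw [sphereMean, ballMean, average_eq, setAverage_eq, Measure.toSphere_real_apply_univ, hball,
    finrank_euclideanSpace_fin, besselJ_eq _ hz, besselJ_eq _ hz,
    show (m : ℝ) / 2 = ((m : ℝ) - 2) / 2 + 1 by ring, Real.rpow_add_one (by positivity)] at h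
  simp only [smul_eq_mul] at h
  have hp : (lam * r / 2) ^ (((m : ℝ) - 2) / 2) ≠ 0 := by positivity
  rw [show (m : ℝ) / 2 = ((m : ℝ) - 2) / 2 + 1 by ring, sphereIntegral]
  generalize besselSeries (((m : ℝ) - 2) / 2 + 1) ((lam * r) ^ 2 / 4) = j at h ⊢
  generalize besselSeries (((m : ℝ) - 2) / 2) ((lam * r) ^ 2 / 4) = j' at h ⊢
  field_simp at h
  linear_combination h

lemma sphereIntegral_eq_of_continuous (hm : 2 ≤ m) {lam R : ℝ} (hlam : 0 < lam) (hR : 0 < R)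
    {u : EuclideanSpace ℝ (Fin m) → ℝ} (hu : Continuous u) {x : EuclideanSpace ℝ (Fin m)}
    (h : ∀ r : ℝ, 0 < r → r < R →
      (m : ℝ) * besselJ ((m : ℝ) / 2) (lam * r) * sphereMean u x r
        = lam * r * besselJ (((m : ℝ) - 2) / 2) (lam * r) * ballMean u x r) :
    ∀ᶠ r in 𝓝[>] (0 : ℝ), sphereIntegral u x r
      = sphereIntegral (fun y => u x * radialSolution lam x y) x r := by
  have hm1 : (0 : ℝ) < m := by positivity
  have hnt : Nontrivial (EuclideanSpace ℝ (Fin m)) := by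
    have : Nonempty (Fin m) := ⟨⟨0, by omega⟩⟩
    infer_instance
  have hm2 : (0 : ℝ) ≤ ((m : ℝ) - 2) / 2 := by
    have : (2 : ℝ) ≤ m := by exact_mod_cast hm
    linarith
  let J := fun r : ℝ => besselSeries ((m : ℝ) / 2) ((lam * r) ^ 2 / 4)
  let K := fun r : ℝ => besselSeries (((m : ℝ) - 2) / 2) ((lam * r) ^ 2 / 4)
  have hJc : Continuous J := (contDiff_besselSeries (by positivity) 0).continuous.comp (by fun_prop)
  have hKc : Continuous K := (contDiff_besselSeries hm2 0).continuous.comp (by fun_prop)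
  have hJ0 : 0 < J 0 := by
    simp only [J, mul_zero]
    norm_num [besselSeries_zero]
    exact Real.Gamma_pos_of_pos (by positivity)
  obtain ⟨δ, hδ, hJpos⟩ := Metric.eventually_nhds_iff.1
    (hJc.continuousAt.eventually (lt_mem_nhds hJ0))
  have hSc : Continuous (sphereIntegral u x) := continuous_integral_sphere _ hu x
  let F := fun r : ℝ => ∫ t in (0 : ℝ)..r, t ^ (m - 1) * sphereIntegral u x t
  have hF : ∀ r, HasDerivAt F (r ^ (m - 1) * sphereIntegral u x r) r := fun r =>
    (Continuous.mul (by fun_prop) hSc : Continuous fun t : ℝ => t ^ (m - 1) * sphereIntegral u x t)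
      |>.integral_hasStrictDerivAt 0 r |>.hasDerivAt
  have hFball : ∀ r : ℝ, 0 ≤ r → ∫ y in ball x r, u y = F r := fun r hr => by
    rw [setIntegral_ball_eq_intervalIntegral _ hu x hr, finrank_euclideanSpace_fin]
    rfl
  have hB := hasDerivAt_pow_mul_besselSeries hm lam
  let B := fun r : ℝ => r ^ m * J r
  let ε := min R δ
  have hε : 0 < ε := lt_min hR hδ
  have hBpos : ∀ r ∈ Ioo 0 ε, 0 < B r := fun r hr => by
    have : dist r 0 < δ := by
      rw [Real.dist_0_eq_abs, abs_of_pos hr.1]; exact hr.2.trans_le (min_le_right _ _)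
    exact mul_pos (pow_pos hr.1 m) (hJpos this)
  have hrel : ∀ r ∈ Ioo 0 ε, B r * sphereIntegral u x r = 2 * K r * F r := fun r hr => by
    rw [← hFball r hr.1.le]
    exact besselSeries_relation hm hlam hr.1 (h r hr.1 (hr.2.trans_le (min_le_left _ _)))
  -- The numerator `F' B - F B'` is `r^(m-1) (B S - 2 K F)`, zero by `hrel`.
  have hquot : ∀ r ∈ Ioo 0 ε, HasDerivAt (fun r => F r / B r) 0 r := fun r hr => by
    refine ((hF r).div (hB r) (hBpos r hr).ne').congr_deriv ?_
    rw [div_eq_zero_iff]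
    left
    have := hrel r hr
    simp only [B, J, K] at this
    linear_combination r ^ (m - 1) * this
  have hconst : ∀ r ∈ Ioo 0 ε, F r / B r = F (ε / 2) / B (ε / 2) := fun r hr =>
    isOpen_Ioo.is_const_of_deriv_eq_zero isPreconnected_Ioo
      (fun s hs => (hquot s hs).differentiableAt.differentiableWithinAt)
      (fun s hs => (hquot s hs).deriv) hr ⟨by linarith, by linarith⟩
  set C := F (ε / 2) / B (ε / 2)
  have hSeq : ∀ r ∈ Ioo 0 ε, sphereIntegral u x r = 2 * C * K r := fun r hr => by
    have h1 := hrel r hr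
    have h2 := hconst r hr
    have h3 := (hBpos r hr).ne'
    rw [div_eq_iff h3] at h2
    rw [h2] at h1
    apply mul_left_cancel₀ h3
    linear_combination h1
  -- Continuity at `0` determines `C`: the left side is `u x` times the area of the unit sphere, and
  -- `K 0 = 1 / Γ(m/2)`.
  have hlim : sphereIntegral u x 0 = 2 * C * K 0 := by
    have h1 : Tendsto (sphereIntegral u x) (𝓝[>] 0) (𝓝 (sphereIntegral u x 0)) :=
      hSc.continuousAt.tendsto.mono_left nhdsWithin_le_nhds
    have h2 : Tendsto (fun r => 2 * C * K r) (𝓝[>] 0) (𝓝 (2 * C * K 0)) :=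
      (continuous_const.mul hKc).continuousAt.tendsto.mono_left nhdsWithin_le_nhds
    refine tendsto_nhds_unique (h1.congr' ?_) h2
    filter_upwards [Ioo_mem_nhdsGT hε] with r hr using hSeq r hr
  have hK0 : K 0 = (Real.Gamma ((m : ℝ) / 2))⁻¹ := by
    simp only [K, mul_zero]
    norm_num [besselSeries_zero]
    congr 1; ring
  have hG : Real.Gamma ((m : ℝ) / 2) ≠ 0 := (Real.Gamma_pos_of_pos (by positivity)).ne'
  filter_upwards [Ioo_mem_nhdsGT hε] with r hr
  have hn : ∀ θ : sphere (0 : EuclideanSpace ℝ (Fin m)) 1,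
      radialSolution lam x (x + r • (θ : EuclideanSpace ℝ (Fin m)))
      = Real.Gamma ((m : ℝ) / 2) * K r := fun θ => by
    have hθ : ‖r • (θ : EuclideanSpace ℝ (Fin m))‖ = r := by
      rw [norm_smul, Real.norm_of_nonneg hr.1.le]; simp
    simp only [radialSolution, K, add_sub_cancel_left, hθ]
    congr 2; ring
  rw [hSeq r hr]
  simp only [sphereIntegral, hn, zero_smul, add_zero, integral_const, smul_eq_mul] at hlim ⊢
  rw [hK0] at hlim
  field_simp at hlim
  linear_combination (-K r) * hlim

lemma contDiff_radialSolution (hm : 2 ≤ m) (lam : ℝ) (x : EuclideanSpace ℝ (Fin m)) (n : ℕ) :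
    ContDiff ℝ n (radialSolution lam x) := by
  have hm2 : (0 : ℝ) ≤ ((m : ℝ) - 2) / 2 := by
    have : (2 : ℝ) ≤ m := by exact_mod_cast hm
    linarith
  exact contDiff_const.mul ((contDiff_besselSeries hm2 n).comp
    (contDiff_const.mul ((contDiff_norm_sq ℝ).comp (contDiff_id.sub contDiff_const))))

lemma radialSolution_self (hm : 2 ≤ m) (lam : ℝ) (x : EuclideanSpace ℝ (Fin m)) :
    radialSolution lam x x = 1 := by
  have hm1 : (0 : ℝ) < m := by positivity
  have hG : Real.Gamma ((m : ℝ) / 2) ≠ 0 := (Real.Gamma_pos_of_pos (by positivity)).ne'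
  simp only [radialSolution, sub_self, norm_zero]
  norm_num [besselSeries_zero]
  rw [show ((m : ℝ) - 2) / 2 + 1 = m / 2 by ring, mul_inv_cancel₀ hG]

/-- Only the centre matters for the comparison. The gradient is `k(y) (y - x)`, so at `x` every pure
second derivative equals `k(x) = -λ²/m`. -/
lemma laplacian_radialSolution_self (hm : 2 ≤ m) (lam : ℝ) (x : EuclideanSpace ℝ (Fin m)) :
    Laplacian.laplacian (radialSolution lam x) x = -lam ^ 2 := by
  have hm1 : (0 : ℝ) < m := by positivity
  have hm2 : (0 : ℝ) ≤ ((m : ℝ) - 2) / 2 := by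
    have : (2 : ℝ) ≤ m := by exact_mod_cast hm
    linarith
  let b := stdOrthonormalBasis ℝ (EuclideanSpace ℝ (Fin m))
  let k := fun y : EuclideanSpace ℝ (Fin m) => -(Real.Gamma ((m : ℝ) / 2) * (lam ^ 2 / 2)
    * besselSeries ((m : ℝ) / 2) (lam ^ 2 / 4 * ‖y - x‖ ^ 2))
  have hk : ContDiff ℝ 1 k := by
    have := contDiff_besselSeries (show (0 : ℝ) ≤ (m : ℝ) / 2 by positivity) 1
    exact (contDiff_const.mul (this.comp (contDiff_const.mul
      ((contDiff_norm_sq ℝ).comp (contDiff_id.sub contDiff_const))))).neg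
  have hd : ∀ y, HasFDerivAt (radialSolution lam x) (k y • innerSL ℝ (y - x)) y := by
    intro y
    have h1 : HasFDerivAt (fun y : EuclideanSpace ℝ (Fin m) => lam ^ 2 / 4 * ‖y - x‖ ^ 2)
        ((lam ^ 2 / 4) • (2 • innerSL ℝ (y - x))) y := by
      have := ((hasStrictFDerivAt_norm_sq (y - x)).hasFDerivAt).comp y
        ((hasFDerivAt_id y).sub_const x)
      refine (this.const_mul (lam ^ 2 / 4)).congr_fderiv ?_
      ext v; simp
    refine (((hasDerivAt_besselSeries hm2 _).comp_hasFDerivAt y h1).const_mul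
      (Real.Gamma ((m : ℝ) / 2))).congr_fderiv ?_
    ext v
    simp only [k, show ((m : ℝ) - 2) / 2 + 1 = m / 2 by ring]
    simp
    ring
  have hk0 : k x = -(lam ^ 2 / m) := by
    have hG : Real.Gamma ((m : ℝ) / 2) ≠ 0 := (Real.Gamma_pos_of_pos (by positivity)).ne'
    simp only [k, sub_self, norm_zero]
    norm_num [besselSeries_zero]
    rw [Real.Gamma_add_one (by positivity)]
    field_simp
  have hdd : ∀ i, fderiv ℝ (fun z => fderiv ℝ (radialSolution lam x) z (b i)) x (b i)
      = -(lam ^ 2 / m) := by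
    intro i
    have h1 : (fun z => fderiv ℝ (radialSolution lam x) z (b i))
        = fun z => k z * inner ℝ (z - x) (b i) := by
      funext z
      rw [(hd z).fderiv]; simp [inner_sub_left]
    have h2 : HasFDerivAt (fun z => k z * inner ℝ (z - x) (b i)) (k x • innerSL ℝ (b i)) x := by
      have h3 : HasFDerivAt (fun z : EuclideanSpace ℝ (Fin m) => inner ℝ (z - x) (b i))
          (innerSL ℝ (b i)) x := by
        have := (innerSL ℝ (b i)).hasFDerivAt.comp x ((hasFDerivAt_id x).sub_const x)
        simpa [Function.comp_def, real_inner_comm] using this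
      refine ((hk.differentiable (by simp) x).hasFDerivAt.mul h3).congr_fderiv ?_
      simp
    rw [h1, h2.fderiv]
    simp [hk0]
  rw [laplacian_eq_sum_fderiv_fderiv b (contDiff_radialSolution hm lam x 2)]
  simp only [hdd, Finset.sum_const, Finset.card_univ, Fintype.card_fin, finrank_euclideanSpace_fin,
    nsmul_eq_mul]
  field_simp

/-- The smooth function `v = c u(x) · radialSolution` can replace `c u`: both have the same value at
`x` and the same small radial averages. The averages of `v - h` therefore do not exceed its value at
`x`, so `Δ(v - h)(x) ≤ 0`, while `Δv(x) = -c λ² u(x)`. -/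
lemma laplacian_ge_of_isLocalMax_of_continuous (hm : 2 ≤ m) {lam : ℝ}
    {u h : EuclideanSpace ℝ (Fin m) → ℝ} {x : EuclideanSpace ℝ (Fin m)}
    (hu : Continuous u) (hmean : ∀ᶠ r in 𝓝[>] (0 : ℝ), sphereIntegral u x r
      = sphereIntegral (fun y => u x * radialSolution lam x y) x r)
    (hh : ContDiff ℝ 2 h) {c : ℝ} (hmax : IsLocalMax (fun y => c * u y - h y) x) :
    -(c * lam ^ 2 * u x) ≤ Laplacian.laplacian h x := by
  have hnt : Nontrivial (EuclideanSpace ℝ (Fin m)) := by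
    have : Nonempty (Fin m) := ⟨⟨0, by omega⟩⟩
    infer_instance
  have hv : ContDiff ℝ 2 (radialSolution lam x) := contDiff_radialSolution hm lam x 2
  have hvc : Continuous (radialSolution lam x) := hv.continuous
  have hhc : Continuous h := hh.continuous
  let v := (c * u x) • radialSolution lam x
  have hv2 : ContDiff ℝ 2 v := hv.const_smul (c * u x)
  have hw : ContDiff ℝ 2 (v - h) := hv2.sub hh
  obtain ⟨ε, hε, hmeanε⟩ := mem_nhdsGT_iff_exists_Ioo_subset.1 hmean
  obtain ⟨δ, hδ, hmaxδ⟩ := Metric.eventually_nhds_iff.1 hmax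
  have key : Laplacian.laplacian (v - h) x ≤ 0 := by
    refine laplacian_nonpos_of_radialAverage_le volume hw ?_
    filter_upwards [Ioo_mem_nhdsGT (lt_min hε hδ)] with a ha
    have hκ : Continuous (radialKernel a : EuclideanSpace ℝ (Fin m) → ℝ) :=
      (contDiff_radialKernel a).continuous
    have hκs := hasCompactSupport_radialKernel (E := EuclideanSpace ℝ (Fin m)) ha.1
    have hint : ∀ {g : EuclideanSpace ℝ (Fin m) → ℝ}, Continuous g →
        Integrable (fun y => g (x + y) * radialKernel a y) volume := fun hg =>
      Continuous.integrable_of_hasCompactSupport (by fun_prop) hκs.mul_left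
    have hf1 : Continuous fun y => c * u y - h y := by fun_prop
    have heq : ∫ y, (v - h) (x + y) * radialKernel a y
        = ∫ y, (c * u (x + y) - h (x + y)) * radialKernel a y := by
      refine integral_congr_of_sphere volume (hint hw.continuous) (hint hf1) fun t ht => ?_
      have hn : ∀ θ : sphere (0 : EuclideanSpace ℝ (Fin m)) 1,
          ‖t • (θ : EuclideanSpace ℝ (Fin m))‖ = t := fun θ => by
        rw [norm_smul, Real.norm_of_nonneg ht.le]; simp
      rcases lt_or_ge a t with hat | hat
      · have : ∀ θ : sphere (0 : EuclideanSpace ℝ (Fin m)) 1,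
            radialKernel a (t • (θ : EuclideanSpace ℝ (Fin m))) = 0 := fun θ =>
          radialKernel_eq_zero ha.1 (by rwa [hn])
        simp [this]
      · have hS := hmeanε ⟨ht, hat.trans_lt (ha.2.trans_le (min_le_left _ _))⟩
        simp only [mem_ofPred_eq, sphereIntegral, integral_const_mul] at hS
        have hi : ∀ {g : EuclideanSpace ℝ (Fin m) → ℝ}, Continuous g → Integrable
            (fun θ : sphere (0 : EuclideanSpace ℝ (Fin m)) 1 =>
              g (x + t • (θ : EuclideanSpace ℝ (Fin m)))) (volume : Measure (EuclideanSpace ℝ (Fin m))).toSphere :=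
          fun hg => Continuous.integrable_of_hasCompactSupport (by fun_prop)
            (HasCompactSupport.of_compactSpace _)
        simp only [radialKernel, hn, integral_mul_const, v, Pi.sub_apply, Pi.smul_apply, smul_eq_mul]
        congr 1
        rw [integral_sub ((hi hvc).const_mul _) (hi hhc), integral_sub ((hi hu).const_mul _) (hi hhc),
          integral_const_mul, integral_const_mul, hS]
        ring
    rw [heq, ← integral_const_mul]
    refine integral_mono (hint hf1) ((hκ.integrable_of_hasCompactSupport hκs).const_mul _)
      fun y => ?_
    rcases le_or_gt ‖y‖ a with hy | hy
    · refine mul_le_mul_of_nonneg_right ?_ (radialKernel_nonneg a y)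
      have : dist (x + y) x < δ := by
        rw [dist_eq_norm, add_sub_cancel_left]
        exact hy.trans_lt (ha.2.trans_le (min_le_right _ _))
      simpa [v, radialSolution_self hm] using hmaxδ this
    · simp [radialKernel_eq_zero ha.1 hy]
  rw [hv2.contDiffAt.laplacian_sub hh.contDiffAt,
    InnerProductSpace.laplacian_smul _ hv.contDiffAt, laplacian_radialSolution_self hm, smul_eq_mul]
    at key
  linarith

/-- A function that has the mean value property at `x` is a solution of the Helmholtz equation at
`x` in the viscosity sense. -/
lemma laplacian_ge_of_isLocalMax (hm : 2 ≤ m) {lam R : ℝ} (hlam : 0 < lam) (hR : 0 < R)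
    {u h : EuclideanSpace ℝ (Fin m) → ℝ} {x : EuclideanSpace ℝ (Fin m)}
    (hu : ContinuousOn u (closedBall x R))
    (hmean : ∀ r : ℝ, 0 < r → r < R →
      (m : ℝ) * besselJ ((m : ℝ) / 2) (lam * r) * sphereMean u x r
        = lam * r * besselJ (((m : ℝ) - 2) / 2) (lam * r) * ballMean u x r)
    (hh : ContDiff ℝ 2 h) {c : ℝ} (hmax : IsLocalMax (fun y => c * u y - h y) x) :
    -(c * lam ^ 2 * u x) ≤ Laplacian.laplacian h x := by
  -- Tietze extension supplies a globally continuous function; all conditions involved are local to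
  -- the ball.
  obtain ⟨w, hw⟩ := ContinuousMap.exists_restrict_eq isClosed_closedBall
    ⟨(closedBall x R).domRestrict u, hu.domRestrict⟩
  have hwu : ∀ y ∈ closedBall x R, w y = u y := fun y hy => congrArg (fun g => g ⟨y, hy⟩) hw
  have hx : w x = u x := hwu x (mem_closedBall_self hR.le)
  rw [← hx]
  refine laplacian_ge_of_isLocalMax_of_continuous hm w.continuous
    (sphereIntegral_eq_of_continuous hm hlam hR w.continuous fun r hr hrR => ?_) hh
    (hmax.congr ?_)
  · convert hmean r hr hrR using 2
    · rw [sphereMean, sphereMean]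
      congr with θ
      refine hwu _ ?_
      rw [mem_closedBall, dist_eq_norm, add_sub_cancel_left, norm_smul, Real.norm_of_nonneg hr.le]
      simpa using hrR.le
    · rw [ballMean, ballMean, setAverage_eq, setAverage_eq, setIntegral_congr_fun measurableSet_ball]
      exact fun y hy => hwu y (ball_subset_closedBall (ball_subset_ball hrR.le hy))
  · filter_upwards [closedBall_mem_nhds x hR] with y hy
    rw [hwu y hy]

end MeanValue

/-! ### Calculus of polynomials and their Laplacian. -/

section Polynomial

open MvPolynomial

variable {ι : Type*}

namespace MvPolynomial

lemma totalDegree_pderiv_le (i : ι) (p : MvPolynomial ι ℝ) :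
    (pderiv i p).totalDegree ≤ p.totalDegree - 1 := by
  classical
  refine Finset.sup_le fun s hs => ?_
  have h : s + Finsupp.single i 1 ∈ p.support := by
    rw [mem_support_iff] at hs ⊢
    intro h0
    simp [coeff_pderiv, h0] at hs
  have := le_totalDegree h
  rw [Finsupp.sum_add_index' (by simp) (by simp), Finsupp.sum_single_index rfl] at this
  omega

variable [Fintype ι]

/-- The Laplacian of a polynomial. -/
noncomputable def lap : MvPolynomial ι ℝ →ₗ[ℝ] MvPolynomial ι ℝ :=
  ∑ i, (pderiv i).toLinearMap ∘ₗ (pderiv i).toLinearMap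

lemma lap_apply (p : MvPolynomial ι ℝ) : lap p = ∑ i, pderiv i (pderiv i p) := by
  simp [lap]

lemma hasFDerivAt_eval (p : MvPolynomial ι ℝ) (z : EuclideanSpace ℝ ι) :
    HasFDerivAt (fun z : EuclideanSpace ℝ ι => eval z.ofLp p)
      (∑ i, eval z.ofLp (pderiv i p) • (EuclideanSpace.proj i : EuclideanSpace ℝ ι →L[ℝ] ℝ)) z := by
  classical
  induction p using MvPolynomial.induction_on with
  | C a => simpa using hasFDerivAt_const a z
  | add p q hp hq =>
    simp only [map_add, add_smul, Finset.sum_add_distrib]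
    exact hp.add hq
  | mul_X p j hp =>
    have hX : HasFDerivAt (fun z : EuclideanSpace ℝ ι => z.ofLp j)
        (EuclideanSpace.proj j : EuclideanSpace ℝ ι →L[ℝ] ℝ) z :=
      (EuclideanSpace.proj j : EuclideanSpace ℝ ι →L[ℝ] ℝ).hasFDerivAt
    simp only [map_mul, eval_X]
    refine (hp.mul hX).congr_fderiv ?_
    simp only [pderiv_mul, pderiv_X, map_add, map_mul, eval_X, add_smul, Finset.sum_add_distrib,
      Finset.smul_sum, smul_smul]
    rw [add_comm]
    congr 1
    · exact Finset.sum_congr rfl fun i _ => by rw [mul_comm]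
    · rw [Finset.sum_eq_single j (fun i _ hij => by simp [Pi.single_eq_of_ne hij.symm])
        (by simp)]
      simp

lemma contDiff_eval (p : MvPolynomial ι ℝ) {n : WithTop ℕ∞} :
    ContDiff ℝ n (fun z : EuclideanSpace ℝ ι => eval z.ofLp p) := by
  induction p using MvPolynomial.induction_on with
  | C a => simpa using contDiff_const
  | add p q hp hq => simpa using hp.add hq
  | mul_X p j hp =>
    simp only [map_mul, eval_X]
    exact hp.mul (EuclideanSpace.proj j : EuclideanSpace ℝ ι →L[ℝ] ℝ).contDiff

lemma continuous_eval_ofLp (p : MvPolynomial ι ℝ) :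
    Continuous (fun z : EuclideanSpace ℝ ι => eval z.ofLp p) :=
  (contDiff_eval p (n := 0)).continuous

lemma fderiv_eval_single [DecidableEq ι] (p : MvPolynomial ι ℝ) (z : EuclideanSpace ℝ ι) (i : ι) :
    fderiv ℝ (fun z : EuclideanSpace ℝ ι => eval z.ofLp p) z (EuclideanSpace.single i 1)
      = eval z.ofLp (pderiv i p) := by
  rw [(hasFDerivAt_eval p z).fderiv]
  simp

lemma hasDerivAt_eval_add_smul [DecidableEq ι] (p : MvPolynomial ι ℝ) (z : EuclideanSpace ℝ ι)
    (i : ι) (s : ℝ) :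
    HasDerivAt (fun s : ℝ => eval (z + s • EuclideanSpace.single i (1 : ℝ)).ofLp p)
      (eval (z + s • EuclideanSpace.single i (1 : ℝ)).ofLp (pderiv i p)) s := by
  have h1 : HasDerivAt (fun s : ℝ => z + s • EuclideanSpace.single i (1 : ℝ))
      (EuclideanSpace.single i (1 : ℝ)) s := by
    simpa using ((hasDerivAt_id s).smul_const (EuclideanSpace.single i (1 : ℝ))).const_add z
  refine ((contDiff_eval p (n := 1)).differentiable (by simp) _ |>.hasFDerivAt.comp_hasDerivAt s h1)
    |>.congr_deriv ?_
  rw [fderiv_eval_single]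

lemma laplacian_eval (p : MvPolynomial ι ℝ) (z : EuclideanSpace ℝ ι) :
    Laplacian.laplacian (fun z : EuclideanSpace ℝ ι => eval z.ofLp p) z = eval z.ofLp (lap p) := by
  classical
  rw [laplacian_eq_sum_fderiv_fderiv (EuclideanSpace.basisFun ι ℝ) (contDiff_eval p), lap_apply,
    map_sum]
  simp only [EuclideanSpace.basisFun_apply, fderiv_eval_single]

/-- The polynomial `z ↦ ‖z - c‖ ^ 2`. -/
noncomputable def sqDist (c : EuclideanSpace ℝ ι) : MvPolynomial ι ℝ :=
  ∑ i, (X i - C (c.ofLp i)) ^ 2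

lemma eval_sqDist (c z : EuclideanSpace ℝ ι) : eval z.ofLp (sqDist c) = ‖z - c‖ ^ 2 := by
  simp [sqDist, EuclideanSpace.norm_sq_eq]

lemma lap_sqDist (c : EuclideanSpace ℝ ι) : lap (sqDist c) = C (2 * Fintype.card ι : ℝ) := by
  classical
  have h1 : ∀ i, pderiv i (sqDist c) = C 2 * (X i - C (c.ofLp i)) := by
    intro i
    rw [sqDist, map_sum, Finset.sum_eq_single i]
    · rw [pderiv_pow]; simp [map_ofNat]
    · intro j _ hj
      rw [pderiv_pow]; simp [pderiv_X_of_ne hj]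
    · simp
  rw [lap_apply]
  simp only [h1, pderiv_C_mul, map_sub, pderiv_X_self, pderiv_C]
  simp [mul_comm]

lemma totalDegree_lap_le (p : MvPolynomial ι ℝ) : (lap p).totalDegree ≤ p.totalDegree - 2 := by
  rw [lap_apply]
  refine totalDegree_finsetSum_le fun i _ => ?_
  have h1 := totalDegree_pderiv_le i p
  have h2 := totalDegree_pderiv_le i (pderiv i p)
  omega

lemma totalDegree_sqDist_le (c : EuclideanSpace ℝ ι) : (sqDist c).totalDegree ≤ 2 := by
  refine totalDegree_finsetSum_le fun i _ => ?_
  refine (totalDegree_pow _ _).trans ?_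
  have := totalDegree_sub_C_le (X i : MvPolynomial ι ℝ) (c.ofLp i)
  rw [totalDegree_X] at this
  omega

/-- The ball contains a product of infinite subsets of the line. -/
lemma eq_zero_of_eval_eq_zero_on_ball {p : MvPolynomial ι ℝ} {c : EuclideanSpace ℝ ι} {R : ℝ}
    (hR : 0 < R) (h : ∀ z ∈ ball c R, eval z.ofLp p = 0) : p = 0 := by
  have hopen : (fun x : ι → ℝ => (WithLp.toLp 2 x : EuclideanSpace ℝ ι)) ⁻¹' ball c R ∈ 𝓝 c.ofLp :=
    (PiLp.continuous_toLp 2 (fun _ : ι => ℝ)).continuousAt.preimage_mem_nhds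
      (ball_mem_nhds c hR)
  obtain ⟨η, hη, hsub⟩ := Metric.mem_nhds_iff.1 hopen
  refine funext_set (fun i => ball (c.ofLp i) η)
    (fun i => infinite_of_mem_nhds _ (ball_mem_nhds _ hη)) fun x hx => ?_
  rw [← ball_pi _ hη] at hx
  simpa using h _ (hsub hx)

end MvPolynomial

/-! ### The maximum principle for viscosity subharmonic functions. -/

section MaximumPrinciple

/-- If `d > 0`, the point is also a local minimum, so `f` is locally constant and `d = 0`. -/
lemma deriv_deriv_nonpos_of_isLocalMax {f f' : ℝ → ℝ} {d s : ℝ} (hf : ∀ t, HasDerivAt f (f' t) t)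
    (hf' : HasDerivAt f' d s) (hmax : IsLocalMax f s) : d ≤ 0 := by
  by_contra! hd
  have h1 : deriv f = f' := funext fun t => (hf t).deriv
  have h2 : deriv (deriv f) s = d := by rw [h1, hf'.deriv]
  have hmin := isLocalMin_of_deriv_deriv_pos (by rwa [h2]) hmax.deriv_eq_zero (hf s).continuousAt
  have hconst : f =ᶠ[𝓝 s] fun _ => f s := by
    filter_upwards [hmin, hmax] with t h3 h4 using le_antisymm h4 h3
  have h5 : deriv f =ᶠ[𝓝 s] fun _ => 0 := by simpa using hconst.deriv
  rw [h5.deriv_eq] at h2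
  simp at h2
  linarith

variable [Fintype ι]
/-- `U` is subharmonic at `z` in the viscosity sense, with polynomials as test functions. -/
def IsViscositySubharmonicAt (U : EuclideanSpace ℝ ι → ℝ) (z : EuclideanSpace ℝ ι) : Prop :=
  ∀ q : MvPolynomial ι ℝ, IsLocalMax (fun w => U w - eval w.ofLp q) z → 0 ≤ eval z.ofLp (lap q)

lemma isViscositySubharmonicAt_eval {p : MvPolynomial ι ℝ} (hp : lap p = 0)
    (z : EuclideanSpace ℝ ι) : IsViscositySubharmonicAt (fun w => eval w.ofLp p) z := by
  classical
  intro q hmax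
  have h : ∀ i, eval z.ofLp (pderiv i (pderiv i (p - q))) ≤ 0 := by
    intro i
    have hd := fun r s => hasDerivAt_eval_add_smul r z i s
    have hd0 := hd (pderiv i (p - q)) 0
    rw [zero_smul, add_zero] at hd0
    refine deriv_deriv_nonpos_of_isLocalMax (hd (p - q)) hd0 ?_
    have hmax' : IsLocalMax (fun w : EuclideanSpace ℝ ι => eval w.ofLp (p - q))
        (z + (0 : ℝ) • EuclideanSpace.single i (1 : ℝ)) := by simpa using hmax
    exact hmax'.comp_continuous (g := fun s : ℝ => z + s • EuclideanSpace.single i (1 : ℝ))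
      (by fun_prop)
  have h2 : eval z.ofLp (lap (p - q)) ≤ 0 := by
    rw [lap_apply, map_sum]
    exact Finset.sum_nonpos fun i _ => h i
  rw [map_sub, hp, zero_sub, map_neg] at h2
  linarith

variable [Nonempty ι]

/-- The maximum principle. -/
lemma le_eval_add_of_le_on_sphere {U : EuclideanSpace ℝ ι → ℝ} {c : EuclideanSpace ℝ ι} {R ε : ℝ}
    (hR : 0 < R) (hU : ContinuousOn U (closedBall c R))
    (hsub : ∀ z ∈ ball c R, IsViscositySubharmonicAt U z)
    {p : MvPolynomial ι ℝ} (hp : lap p = 0) (hle : ∀ z ∈ sphere c R, U z ≤ eval z.ofLp p + ε)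
    {z : EuclideanSpace ℝ ι} (hz : z ∈ closedBall c R) : U z ≤ eval z.ofLp p + ε := by
  have key : ∀ δ > 0, U z - eval z.ofLp p ≤ ε + δ * R ^ 2 := by
    intro δ hδ
    -- The perturbation makes `lap q` a negative constant, so `U - q` has no interior maximum; on
    -- the sphere it costs exactly `δ R²`.
    let q := p - C δ * sqDist c
    have hq : ∀ w : EuclideanSpace ℝ ι,
        eval w.ofLp q = eval w.ofLp p - δ * ‖w - c‖ ^ 2 := fun w => by
      simp [q, eval_sqDist]
    obtain ⟨w, hw, hmax⟩ := (isCompact_closedBall c R).exists_isMaxOn ⟨z, hz⟩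
      (hU.sub (continuous_eval_ofLp q).continuousOn)
    have hws : w ∈ sphere c R := by
      by_contra hns
      have hwb : w ∈ ball c R := lt_of_le_of_ne hw hns
      have h1 := hsub w hwb q (hmax.isLocalMax (closedBall_mem_nhds_of_mem hwb))
      have h2 : lap q = -C (δ * (2 * Fintype.card ι)) := by
        simp only [q, map_sub, hp, zero_sub, ← smul_eq_C_mul, map_smul, lap_sqDist]
        simp [smul_eq_C_mul]
      rw [h2, map_neg, eval_C] at h1
      have : (0 : ℝ) < Fintype.card ι := by exact_mod_cast Fintype.card_pos
      have : 0 < δ * (2 * Fintype.card ι) := by positivity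
      linarith
    have h1 : U z - eval z.ofLp q ≤ U w - eval w.ofLp q := hmax hz
    have h2 := hle w hws
    rw [hq, hq] at h1
    rw [mem_sphere, dist_eq_norm] at hws
    rw [hws] at h1
    nlinarith [sq_nonneg ‖z - c‖]
  refine le_of_forall_pos_le_add fun η hη => ?_
  have := key (η / R ^ 2) (by positivity)
  rw [div_mul_cancel₀ _ (by positivity)] at this
  linarith

end MaximumPrinciple

/-! ### The Dirichlet problem on balls and approximation by harmonic polynomials. -/

section Dirichlet

variable [Fintype ι]

lemma exists_eval_near {K : Set (EuclideanSpace ℝ ι)} (hK : IsCompact K)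
    {g : EuclideanSpace ℝ ι → ℝ} (hg : ContinuousOn g K) {ε : ℝ} (hε : 0 < ε) :
    ∃ p : MvPolynomial ι ℝ, ∀ z ∈ K, |eval z.ofLp p - g z| < ε := by
  have := isCompact_iff_compactSpace.1 hK
  let x : ι → C(K, ℝ) := fun i => ⟨fun z => (z : EuclideanSpace ℝ ι).ofLp i, by fun_prop⟩
  have hx : ∀ (p : MvPolynomial ι ℝ) (z : K), aeval x p z = eval (z : EuclideanSpace ℝ ι).ofLp p := by
    intro p z
    induction p using MvPolynomial.induction_on with
    | C a => simp
    | add p q hp hq => simp [hp, hq]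
    | mul_X p j hp => simp [hp, x]
  have hsep : (aeval x : MvPolynomial ι ℝ →ₐ[ℝ] C(K, ℝ)).range.SeparatesPoints := by
    intro z w hzw
    obtain ⟨i, hi⟩ : ∃ i, (z : EuclideanSpace ℝ ι).ofLp i ≠ (w : EuclideanSpace ℝ ι).ofLp i := by
      by_contra! h
      exact hzw (Subtype.ext (PiLp.ext h))
    exact ⟨x i, ⟨x i, ⟨X i, by simp⟩, rfl⟩, hi⟩
  obtain ⟨⟨_, p, rfl⟩, hp⟩ :=
    ContinuousMap.exists_mem_subalgebra_near_continuous_of_separatesPoints _ hsep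
      (K.domRestrict g) hg.domRestrict ε hε
  refine ⟨p, fun z hz => ?_⟩
  have := hp ⟨z, hz⟩
  rw [Real.norm_eq_abs] at this
  simpa [hx] using this

variable [Nonempty ι]

/-- The product is harmonic and vanishes on the sphere, hence in the ball by the maximum principle,
where its first factor is positive. -/
lemma eq_zero_of_lap_sub_sqDist_mul_eq_zero {c : EuclideanSpace ℝ ι} {R : ℝ} (hR : 0 < R)
    {q : MvPolynomial ι ℝ} (h : lap ((C (R ^ 2) - sqDist c) * q) = 0) : q = 0 := by
  have hle : ∀ r : MvPolynomial ι ℝ, lap ((C (R ^ 2) - sqDist c) * r) = 0 →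
      ∀ z ∈ ball c R, (R ^ 2 - ‖z - c‖ ^ 2) * eval z.ofLp r ≤ 0 := by
    intro r hr z hz
    have := le_eval_add_of_le_on_sphere (p := 0) (ε := 0) hR (continuous_eval_ofLp _).continuousOn
      (fun z _ => isViscositySubharmonicAt_eval hr z) (map_zero _) (fun w hw => ?_)
      (ball_subset_closedBall hz)
    · simpa [eval_sqDist] using this
    · rw [mem_sphere, dist_eq_norm] at hw
      simp [eval_sqDist, hw]
  refine eq_zero_of_eval_eq_zero_on_ball (c := c) hR fun z hz => ?_
  have h1 := hle q h z hz
  have h2 := hle (-q) (by rw [mul_neg, map_neg, h, neg_zero]) z hz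
  rw [map_neg, mul_neg] at h2
  rw [mem_ball, dist_eq_norm] at hz
  have h3 : 0 < R ^ 2 - ‖z - c‖ ^ 2 := by nlinarith [norm_nonneg (z - c)]
  have h4 : (R ^ 2 - ‖z - c‖ ^ 2) * eval z.ofLp q = 0 := le_antisymm h1 (by linarith)
  exact (mul_eq_zero.1 h4).resolve_left h3.ne'

/-- The Dirichlet problem for a ball with polynomial data has a polynomial solution. -/
lemma exists_lap_eq_zero_eq_on_sphere (c : EuclideanSpace ℝ ι) {R : ℝ} (hR : 0 < R)
    (q : MvPolynomial ι ℝ) : ∃ p : MvPolynomial ι ℝ, lap p = 0 ∧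
      ∀ z ∈ sphere c R, eval z.ofLp p = eval z.ofLp q := by
  let s : MvPolynomial ι ℝ := C (R ^ 2) - sqDist c
  let V := restrictTotalDegree ι ℝ q.totalDegree
  -- Multiplication by `s` raises the degree by at most two and `lap` lowers it by two, so `T` acts
  -- on the finite-dimensional space `V`. Injectivity gives surjectivity, and adding a multiple of
  -- `s` leaves the boundary values unchanged.
  let T : MvPolynomial ι ℝ →ₗ[ℝ] MvPolynomial ι ℝ := lap ∘ₗ LinearMap.mulLeft ℝ s
  have hs : s.totalDegree ≤ 2 := by
    refine (totalDegree_sub _ _).trans (max_le ?_ (totalDegree_sqDist_le c))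
    rw [totalDegree_C]
    exact Nat.zero_le _
  have hT : ∀ r ∈ V, T r ∈ V := by
    intro r hr
    rw [mem_restrictTotalDegree] at hr ⊢
    have h1 := totalDegree_lap_le (s * r)
    have h2 := totalDegree_mul s r
    change (lap (s * r)).totalDegree ≤ _
    omega
  have hinj : Function.Injective (T.restrict hT) := by
    rw [injective_iff_map_eq_zero]
    intro r hr
    have : lap (s * (r : MvPolynomial ι ℝ)) = 0 := congrArg Subtype.val hr
    exact Subtype.ext (eq_zero_of_lap_sub_sqDist_mul_eq_zero hR this)
  have hmem : -lap q ∈ V := by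
    rw [mem_restrictTotalDegree, totalDegree_neg]
    exact (totalDegree_lap_le q).trans (Nat.sub_le _ _)
  obtain ⟨r, hr⟩ := LinearMap.injective_iff_surjective.1 hinj ⟨-lap q, hmem⟩
  have hr' : lap (s * (r : MvPolynomial ι ℝ)) = -lap q := congrArg Subtype.val hr
  refine ⟨q + s * (r : MvPolynomial ι ℝ), by rw [map_add, hr', add_neg_cancel], fun z hz => ?_⟩
  rw [mem_sphere, dist_eq_norm] at hz
  simp [s, eval_sqDist, hz]

/-- A continuous function which is harmonic in the viscosity sense is a uniform limit of harmonic
polynomials on closed balls. -/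
lemma exists_lap_eq_zero_near {U : EuclideanSpace ℝ ι → ℝ} {c : EuclideanSpace ℝ ι} {R ε : ℝ}
    (hR : 0 < R) (hU : ContinuousOn U (closedBall c R))
    (hsub : ∀ z ∈ ball c R, IsViscositySubharmonicAt U z)
    (hsup : ∀ z ∈ ball c R, IsViscositySubharmonicAt (fun w => -U w) z) (hε : 0 < ε) :
    ∃ p : MvPolynomial ι ℝ, lap p = 0 ∧ ∀ z ∈ closedBall c R, |U z - eval z.ofLp p| ≤ ε := by
  -- The boundary values are approximated by Stone–Weierstrass; the maximum principle for `U`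
  -- against `p` and `-U` against `-p` carries the error inside.
  obtain ⟨q, hq⟩ := exists_eval_near (isCompact_sphere c R) (hU.mono sphere_subset_closedBall) hε
  obtain ⟨p, hp, hpq⟩ := exists_lap_eq_zero_eq_on_sphere c hR q
  refine ⟨p, hp, fun z hz => abs_le.2 ⟨?_, ?_⟩⟩
  · have := le_eval_add_of_le_on_sphere (p := -p) (ε := ε) hR hU.neg hsup (by rw [map_neg, hp, neg_zero])
      (fun w hw => ?_) hz
    · rw [map_neg, Pi.neg_apply] at this; linarith
    · have := abs_lt.1 (hq w hw)
      rw [map_neg, hpq w hw, Pi.neg_apply]; linarith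
  · have := le_eval_add_of_le_on_sphere (ε := ε) hR hU hsub hp (fun w hw => ?_) hz
    · linarith
    · have := abs_lt.1 (hq w hw)
      rw [hpq w hw]; linarith

end Dirichlet

end Polynomial

/-! ### Smoothness of viscosity harmonic functions. -/

section Regularity

open MvPolynomial

/-- A continuous function which is harmonic in the viscosity sense is smooth. -/
lemma exists_contDiff_eqOn_ball {ι : Type*} [Fintype ι] [Nonempty ι] {U : EuclideanSpace ℝ ι → ℝ}
    {c : EuclideanSpace ℝ ι} {R : ℝ} (hR : 0 < R) (hU : ContinuousOn U (closedBall c R))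
    (hsub : ∀ z ∈ ball c R, IsViscositySubharmonicAt U z)
    (hsup : ∀ z ∈ ball c R, IsViscositySubharmonicAt (fun w => -U w) z) :
    ∃ V : EuclideanSpace ℝ ι → ℝ, ContDiff ℝ ∞ V ∧ EqOn U V (ball c (R / 2)) := by
  obtain ⟨w, hw⟩ := ContinuousMap.exists_restrict_eq isClosed_closedBall
    ⟨(closedBall c R).domRestrict U, hU.domRestrict⟩
  have hwU : ∀ y ∈ closedBall c R, w y = U y := fun y hy => congrArg (fun g => g ⟨y, hy⟩) hw
  have hwc : Continuous w := w.continuous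
  -- For a centre within `R / 2` of `c`, the support of the kernel then stays inside the ball of
  -- radius `R`.
  let a := R / 2
  have ha : 0 < a := half_pos hR
  let κ : EuclideanSpace ℝ ι → ℝ := radialKernel a
  have hκ : Continuous κ := (contDiff_radialKernel a).continuous
  have hκs : HasCompactSupport κ := hasCompactSupport_radialKernel ha
  have hκi : Integrable κ volume := hκ.integrable_of_hasCompactSupport hκs
  let A := ∫ y, κ y
  have hA : 0 < A := integral_radialKernel_pos volume ha
  have hmean : ∀ z ∈ ball c a, ∫ y, w (z + y) * κ y = w z * A := by
    intro z hz
    have hmem : ∀ y : EuclideanSpace ℝ ι, ‖y‖ ≤ a → z + y ∈ closedBall c R := by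
      intro y hy
      rw [mem_ball, dist_eq_norm] at hz
      rw [mem_closedBall, dist_eq_norm, add_sub_right_comm]
      have := norm_add_le (z - c) y
      simp only [a] at hz hy
      linarith
    -- Replacing `w` by a harmonic polynomial within `ε / (2A)` costs `ε / 2` in the average and `ε
    -- / 2` in the value at `z`.
    have hle : ∀ ε > 0, |(∫ y, w (z + y) * κ y) - w z * A| ≤ ε := by
      intro ε hε
      obtain ⟨p, hp, hUp⟩ := exists_lap_eq_zero_near hR hU hsub hsup
        (show 0 < ε / (2 * A) by positivity)
      have hpm := integral_radialKernel_of_laplacian_eq_zero volume (contDiff_eval p)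
        (fun x => by rw [laplacian_eval, hp, map_zero]) ha z
      have hpc := continuous_eval_ofLp p
      have hi1 : Integrable (fun y => w (z + y) * κ y) volume :=
        Continuous.integrable_of_hasCompactSupport (by fun_prop) hκs.mul_left
      have hi2 : Integrable (fun y => eval (z + y).ofLp p * κ y) volume :=
        Continuous.integrable_of_hasCompactSupport
          ((hpc.comp (continuous_const.add continuous_id)).mul hκ) hκs.mul_left
      have h1 : |(∫ y, w (z + y) * κ y) - ∫ y, eval (z + y).ofLp p * κ y| ≤ ε / (2 * A) * A := by
        rw [← integral_sub hi1 hi2, ← integral_const_mul, ← Real.norm_eq_abs]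
        refine norm_integral_le_of_norm_le (hκi.const_mul _) (Eventually.of_forall fun y => ?_)
        rw [← sub_mul, norm_mul, Real.norm_of_nonneg (radialKernel_nonneg a y)]
        rcases le_or_gt ‖y‖ a with hy | hy
        · refine mul_le_mul_of_nonneg_right ?_ (radialKernel_nonneg a y)
          rw [hwU _ (hmem y hy)]
          exact hUp _ (hmem y hy)
        · simp [κ, radialKernel_eq_zero ha hy]
      have hz0 : z ∈ closedBall c R := by simpa using hmem 0 (by simpa using ha.le)
      have h2 : |w z * A - eval z.ofLp p * A| ≤ ε / (2 * A) * A := by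
        rw [← sub_mul, abs_mul, abs_of_pos hA, hwU z hz0]
        exact mul_le_mul_of_nonneg_right (hUp z hz0) hA.le
      have h3 : ε / (2 * A) * A = ε / 2 := by field_simp
      rw [h3] at h1 h2
      rw [show (∫ y, eval (z + y).ofLp p * κ y) = eval z.ofLp p * A from hpm] at h1
      rw [abs_le] at h1 h2 ⊢
      constructor <;> linarith [h1.1, h1.2, h2.1, h2.2]
    exact sub_eq_zero.1 (abs_eq_zero.1 (le_antisymm (le_of_forall_pos_le_add fun ε hε => by
      simpa using hle ε hε) (abs_nonneg _)))
  -- The kernel is even, so averaging about `z` is a convolution.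
  have hconv : ∀ z, (convolution w κ (ContinuousLinearMap.mul ℝ ℝ) volume) z
      = ∫ y, w (z + y) * κ y := by
    intro z
    rw [convolution, ← integral_add_left_eq_self _ z]
    refine integral_congr_ae (Eventually.of_forall fun y => ?_)
    simp [κ, radialKernel_neg]
  refine ⟨fun z => A⁻¹ * (convolution w κ (ContinuousLinearMap.mul ℝ ℝ) volume) z,
    contDiff_const.mul (hκs.contDiff_convolution_right _ hwc.locallyIntegrable
      (contDiff_radialKernel a)), fun z hz => ?_⟩
  simp only [hconv, hmean z hz]
  rw [hwU z (ball_subset_closedBall (ball_subset_ball (by linarith) hz))]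
  field_simp

/-! ### Harmonic extension by one variable. -/

variable {m : ℕ}

/-- The embedding `x ↦ (x, 0)`. -/
noncomputable def snocZero : EuclideanSpace ℝ (Fin m) →L[ℝ] EuclideanSpace ℝ (Fin (m + 1)) :=
  ∑ i : Fin m, (EuclideanSpace.proj i : EuclideanSpace ℝ (Fin m) →L[ℝ] ℝ).smulRight
    (EuclideanSpace.single i.castSucc (1 : ℝ))

/-- The projection `(x, t) ↦ x`. -/
noncomputable def dropLast : EuclideanSpace ℝ (Fin (m + 1)) →L[ℝ] EuclideanSpace ℝ (Fin m) :=
  ∑ i : Fin m, (EuclideanSpace.proj i.castSucc : EuclideanSpace ℝ (Fin (m + 1)) →L[ℝ] ℝ).smulRight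
    (EuclideanSpace.single i (1 : ℝ))

lemma dropLast_apply (z : EuclideanSpace ℝ (Fin (m + 1))) (i : Fin m) :
    dropLast z i = z i.castSucc := by
  simp [dropLast, Pi.single_apply]

lemma snocZero_castSucc (x : EuclideanSpace ℝ (Fin m)) (i : Fin m) :
    snocZero x i.castSucc = x i := by
  simp [snocZero, Pi.single_apply]

lemma snocZero_last (x : EuclideanSpace ℝ (Fin m)) : snocZero x (Fin.last m) = 0 := by
  simp [snocZero, (Fin.castSucc_lt_last _).ne']

lemma dropLast_snocZero (x : EuclideanSpace ℝ (Fin m)) : dropLast (snocZero x) = x := by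
  ext i; rw [dropLast_apply, snocZero_castSucc]

lemma snocZero_single (i : Fin m) :
    snocZero (EuclideanSpace.single i (1 : ℝ)) = EuclideanSpace.single i.castSucc 1 := by
  simp [snocZero]

lemma dropLast_single_last :
    dropLast (EuclideanSpace.single (Fin.last m) (1 : ℝ)) = 0 := by
  ext i; rw [dropLast_apply]; simp [(Fin.castSucc_lt_last _).ne]

lemma norm_dropLast_le (z : EuclideanSpace ℝ (Fin (m + 1))) : ‖dropLast z‖ ≤ ‖z‖ := by
  refine (sq_le_sq₀ (norm_nonneg _) (norm_nonneg _)).1 ?_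
  rw [EuclideanSpace.norm_sq_eq, EuclideanSpace.norm_sq_eq, Fin.sum_univ_castSucc]
  simp only [dropLast_apply]
  exact le_add_of_nonneg_right (by positivity)

/-- The harmonic extension `(x, t) ↦ u x * cosh (lam * t)` of a solution of the Helmholtz
equation. -/
noncomputable def coshExtension (lam : ℝ) (u : EuclideanSpace ℝ (Fin m) → ℝ)
    (z : EuclideanSpace ℝ (Fin (m + 1))) : ℝ :=
  u (dropLast z) * Real.cosh (lam * z (Fin.last m))

lemma coshExtension_snocZero (lam : ℝ) (u : EuclideanSpace ℝ (Fin m) → ℝ)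
    (x : EuclideanSpace ℝ (Fin m)) : coshExtension lam u (snocZero x) = u x := by
  simp [coshExtension, dropLast_snocZero, snocZero_last]

lemma laplacian_eval_slice (q : MvPolynomial (Fin (m + 1)) ℝ) (z : EuclideanSpace ℝ (Fin (m + 1)))
    (x y : EuclideanSpace ℝ (Fin m)) :
    Laplacian.laplacian (fun y : EuclideanSpace ℝ (Fin m) => eval (z + snocZero (y - x)).ofLp q) y
      = ∑ i : Fin m, eval (z + snocZero (y - x)).ofLp
          (pderiv i.castSucc (pderiv i.castSucc q)) := by
  have hA : ∀ y, HasFDerivAt (fun y => z + snocZero (y - x)) snocZero y := fun y =>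
    (snocZero.hasFDerivAt.comp y ((hasFDerivAt_id y).sub_const x)).const_add z
  have hd : ∀ (r : MvPolynomial (Fin (m + 1)) ℝ) (y) (i : Fin m),
      fderiv ℝ (fun y => eval (z + snocZero (y - x)).ofLp r) y (EuclideanSpace.single i (1 : ℝ))
        = eval (z + snocZero (y - x)).ofLp (pderiv i.castSucc r) := by
    intro r y i
    have h1 := ((contDiff_eval r (n := 1)).differentiable (by simp)
      (z + snocZero (y - x))).hasFDerivAt.comp y (hA y)
    have h2 : fderiv ℝ (fun y => eval (z + snocZero (y - x)).ofLp r) y = _ := h1.fderiv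
    rw [h2, ContinuousLinearMap.comp_apply, snocZero_single, fderiv_eval_single]
  have hq : ContDiff ℝ 2 (fun y => eval (z + snocZero (y - x)).ofLp q) :=
    (contDiff_eval q).comp (contDiff_const.add (snocZero.contDiff.comp
      (contDiff_id.sub contDiff_const)))
  rw [laplacian_eq_sum_fderiv_fderiv (EuclideanSpace.basisFun (Fin m) ℝ) hq]
  simp only [EuclideanSpace.basisFun_apply, hd]

/-- The test polynomial is examined on the slices through `z`. At fixed `t` the Helmholtz inequality
for `u` bounds the horizontal second derivatives below by `-c λ² u cosh(λt)`; at fixed `x` the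
explicit `cosh` bounds the vertical one below by `+c λ² u cosh(λt)`. The sum is nonnegative for
either sign of `c`, so `c = ±1` covers sub- and superharmonicity. -/
lemma isViscositySubharmonicAt_coshExtension (hm : 2 ≤ m) {lam R : ℝ} (hlam : 0 < lam)
    (hR : 0 < R) {u : EuclideanSpace ℝ (Fin m) → ℝ} {z : EuclideanSpace ℝ (Fin (m + 1))}
    (hu : ContinuousOn u (closedBall (dropLast z) R))
    (hmean : ∀ r : ℝ, 0 < r → r < R →
      (m : ℝ) * besselJ ((m : ℝ) / 2) (lam * r) * sphereMean u (dropLast z) r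
        = lam * r * besselJ (((m : ℝ) - 2) / 2) (lam * r) * ballMean u (dropLast z) r) (c : ℝ) :
    IsViscositySubharmonicAt (fun w => c * coshExtension lam u w) z := by
  intro q hmax
  set x := dropLast z with hx
  let t := z (Fin.last m)
  let A := fun y : EuclideanSpace ℝ (Fin m) => z + snocZero (y - x)
  have hAx : A x = z := by simp [A]
  have hAc : Continuous A := by fun_prop
  have hAdrop : ∀ y, dropLast (A y) = y := fun y => by
    simp only [A, map_add, dropLast_snocZero, ← hx, add_sub_cancel]
  have hAlast : ∀ y, A y (Fin.last m) = t := fun y => by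
    simp [A, snocZero_last, t]
  have hspace : -(c * Real.cosh (lam * t) * lam ^ 2 * u x)
      ≤ ∑ i : Fin m, eval z.ofLp (pderiv i.castSucc (pderiv i.castSucc q)) := by
    have hq : ContDiff ℝ 2 (fun y => eval (A y).ofLp q) :=
      (contDiff_eval q).comp (contDiff_const.add (snocZero.contDiff.comp
        (contDiff_id.sub contDiff_const)))
    have h1 : IsLocalMax (fun y => c * Real.cosh (lam * t) * u y - eval (A y).ofLp q) x := by
      have h2 : IsLocalMax (fun w => c * coshExtension lam u w - eval w.ofLp q) (A x) := by
        rwa [hAx]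
      refine (h2.comp_continuous hAc.continuousAt).congr (Eventually.of_forall fun y => ?_)
      simp only [Function.comp, coshExtension, hAdrop, hAlast]
      ring
    have h3 := laplacian_ge_of_isLocalMax hm hlam hR hu hmean hq h1
    rw [laplacian_eval_slice q z x x] at h3
    simpa using h3
  have htime : c * u x * (lam * (lam * Real.cosh (lam * t)))
      - eval z.ofLp (pderiv (Fin.last m) (pderiv (Fin.last m) q)) ≤ 0 := by
    let e : EuclideanSpace ℝ (Fin (m + 1)) := EuclideanSpace.single (Fin.last m) (1 : ℝ)
    have hl : ∀ s : ℝ, HasDerivAt (fun s : ℝ => lam * (t + s)) lam s := fun s => by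
      simpa using ((hasDerivAt_id s).const_add t).const_mul lam
    have hd1 : ∀ s : ℝ, HasDerivAt (fun s : ℝ => c * u x * Real.cosh (lam * (t + s))
        - eval (z + s • e).ofLp q)
        (c * u x * (Real.sinh (lam * (t + s)) * lam) - eval (z + s • e).ofLp (pderiv (Fin.last m) q)) s :=
      fun s => (((Real.hasDerivAt_cosh _).comp s (hl s)).const_mul _).sub
        (hasDerivAt_eval_add_smul q z (Fin.last m) s)
    have hd2 := ((((Real.hasDerivAt_sinh _).comp 0 (hl 0)).mul_const lam).const_mul (c * u x)).sub
        (hasDerivAt_eval_add_smul (pderiv (Fin.last m) q) z (Fin.last m) 0)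
    have h1 : IsLocalMax (fun s : ℝ => c * u x * Real.cosh (lam * (t + s))
        - eval (z + s • e).ofLp q) 0 := by
      have h2 : IsLocalMax (fun w => c * coshExtension lam u w - eval w.ofLp q)
          ((fun s : ℝ => z + s • e) 0) := by simpa using hmax
      refine (h2.comp_continuous (g := fun s : ℝ => z + s • e) (b := 0) (by fun_prop)).congr
        (Eventually.of_forall fun s => ?_)
      simp only [Function.comp, coshExtension, map_add, map_smul, e, dropLast_single_last, ← hx]
      simp [t]
      ring
    have := deriv_deriv_nonpos_of_isLocalMax hd1 hd2 h1
    simp only [zero_smul, add_zero] at this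
    linarith
  rw [lap_apply, map_sum, Fin.sum_univ_castSucc]
  linarith

end Regularity

/-! ### Conclusion. -/

theorem theorem5 (m : ℕ) (hm : 2 ≤ m) (D : Set (EuclideanSpace ℝ (Fin m)))
    (hD_open : IsOpen D) (hD_conn : IsConnected D) (hD_bdd : Bornology.IsBounded D)
    (lam : ℝ) (hlam : 0 < lam)
    (u : EuclideanSpace ℝ (Fin m) → ℝ) (hu : ContinuousOn u D)
    (hmean : ∀ x ∈ D, ∃ R : ℝ, 0 < R ∧ Metric.closedBall x R ⊆ D ∧
      ∀ r : ℝ, 0 < r → r < R →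
        (m : ℝ) * besselJ ((m : ℝ) / 2) (lam * r) * sphereMean u x r
          = lam * r * besselJ (((m : ℝ) - 2) / 2) (lam * r) * ballMean u x r) :
    IsMetaharmonicOn lam u D := by
  have hvisc : ∀ z : EuclideanSpace ℝ (Fin (m + 1)), dropLast z ∈ D → ∀ c : ℝ,
      IsViscositySubharmonicAt (fun w => c * coshExtension lam u w) z := by
    intro z hz c
    obtain ⟨R, hR, hRD, h⟩ := hmean _ hz
    exact isViscositySubharmonicAt_coshExtension hm hlam hR (hu.mono hRD) h c
  have hsmooth : ∀ x ∈ D, ∃ h : EuclideanSpace ℝ (Fin m) → ℝ, ContDiff ℝ 2 h ∧ u =ᶠ[𝓝 x] h := by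
    intro x hx
    obtain ⟨R, hR, hRD, -⟩ := hmean x hx
    have hdrop : ∀ z ∈ closedBall (snocZero x) R, dropLast z ∈ D := by
      intro z hz
      refine hRD ?_
      rw [mem_closedBall, dist_eq_norm] at hz ⊢
      rw [← dropLast_snocZero x, ← map_sub]
      exact (norm_dropLast_le _).trans hz
    have hU : ContinuousOn (coshExtension lam u) (closedBall (snocZero x) R) :=
      (hu.comp dropLast.continuous.continuousOn hdrop).mul (Continuous.continuousOn (by fun_prop))
    obtain ⟨V, hV, hUV⟩ := exists_contDiff_eqOn_ball hR hU
      (fun z hz => by simpa using hvisc z (hdrop z (ball_subset_closedBall hz)) 1)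
      (fun z hz => by simpa using hvisc z (hdrop z (ball_subset_closedBall hz)) (-1))
    refine ⟨V ∘ snocZero, (hV.of_le (by norm_cast)).comp snocZero.contDiff, ?_⟩
    filter_upwards [snocZero.continuous.continuousAt.preimage_mem_nhds
      (ball_mem_nhds (snocZero x) (half_pos hR))] with y hy
    rw [Function.comp_apply, ← hUV hy, coshExtension_snocZero]
  refine ⟨fun x hx => ?_, fun x hx => ?_⟩
  · obtain ⟨h, hh, huh⟩ := hsmooth x hx
    exact (hh.contDiffAt.congr_of_eventuallyEq huh).contDiffWithinAt
  · obtain ⟨h, hh, huh⟩ := hsmooth x hx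
    obtain ⟨R, hR, hRD, hmeanx⟩ := hmean x hx
    have hmax : ∀ g : EuclideanSpace ℝ (Fin m) → ℝ, g =ᶠ[𝓝 x] (fun _ => 0) → IsLocalMax g x := by
      intro g hg
      filter_upwards [hg] with y hy
      rw [hy, hg.self_of_nhds]
    -- As `u = h` near `x`, both `u - h` and `-u - (-h)` vanish there and have a trivial local
    -- maximum; the viscosity inequalities for `c = 1` and `c = -1` together give equality.
    have h1 := laplacian_ge_of_isLocalMax hm hlam hR (hu.mono hRD) hmeanx hh (c := 1)
      (hmax _ (by filter_upwards [huh] with y hy; rw [hy]; ring))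
    have h2 := laplacian_ge_of_isLocalMax hm hlam hR (hu.mono hRD) hmeanx hh.neg (c := -1)
      (hmax _ (by filter_upwards [huh] with y hy; rw [hy]; simp))
    have h3 : Laplacian.laplacian (fun y => -h y) x = -Laplacian.laplacian h x := by
      have := InnerProductSpace.laplacian_neg (f := h)
      exact congrFun this x
    rw [h3] at h2
    rw [InnerProductSpace.laplacian_congr_nhds huh |>.self_of_nhds]
    linarith
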